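/- Let $p$ be an odd prime, let $e\equiv 2\pmod 4$ be a positive integer, $q=p^e$, and let $\mathrm{Tr}$ be the trace from $\mathbb{F}_q$ to $\mathbb{F}_p$. Let $\eta$ be the quadratic character of $\mathbb{F}_p$, and let $C_0$ and $C_1$ be the sets of nonzero squares and of non-squares in $\mathbb{F}_p^*$. For $i\in\{0,1\}$ put $$D_i=\{x\in\mathbb{F}_q:\mathrm{Tr}(x^{p+1}-x)\in C_i\},\qquad \mathcal{C}_{D_i}=\{(\mathrm{Tr}(ax))_{x\in D_i}:a\in\mathbb{F}_q\},$$ a linear code over $\mathbb{F}_p$ of length $|D_i|$. Suppose that the Legendre symbol satisfies $\left(\frac{e}{p}\right)=(-1)^{1-i}$. Then $\mathcal{C}_{D_i}$ has length $$|D_i|=\frac{p-1}{2}p^{e-1}-\frac{1-\eta(-1)p}{2}p^{\frac e2-1}$$ and at most $5$ nonzero weights. If moreover $(p,e)\neq(3,2)$, then $\mathcal{C}_{D_i}$ has dimension $e$ over $\mathbb{F}_p$, and its weight distribution (the number of codewords of each Hamming weight) is given by the following tables, in which multiplicities belonging to equal weights are added and weights that are not listed do not occur. If $p\equiv1\pmod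 4$: $$\begin{array}{ll} \text{Weight}&\text{Multiplicity}\\ 0&1\\ \frac{(p-1)^2}{2}p^{e-2}&p^{e-1}-1\\ \frac{(p-1)^2}{2}p^{e-2}+\frac{p-1}{2}p^{\frac e2-1}&\frac{p^2-1}{2}p^{e-2}\\ \frac{(p-1)^2}{2}p^{e-2}+\frac{p-3}{2}p^{\frac e2-1}&\frac{(p-1)^2}{4}p^{e-2}-\frac{(p-1)^2}{4}p^{\frac e2-1}\\ \frac{(p-1)^2}{2}p^{e-2}+\frac{p+1}{2}p^{\frac e2-1}&\frac{(p-1)^2}{4}p^{e-2}+\frac{(p-1)^2}{4}p^{\frac e2-1} \end{array}$$ If $p\equiv3\pmod 4$: $$\begin{array}{ll} \text{Weight}&\text{Multiplicity}\\ 0&1\\ \frac{(p-1)^2}{2}p^{e-2}&p^{e-2}-1\\ \frac{(p-1)^2}{2}p^{e-2}-\frac{p+1}{2}p^{\frac e2-1}&\frac{p^2-1}{2}p^{e-2}-(p-1)p^{\frac e2-1}\\ \frac{(p-1)^2}{2}p^{e-2}-\frac{p+3}{2}p^{\frac e2-1}&\frac{(p-1)(p-3)}{4}p^{e-2}-\frac{(p-1)(p-3)}{4}p^{\frac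 e2-1}\\ \frac{(p-1)^2}{2}p^{e-2}-\frac{p-1}{2}p^{\frac e2-1}&\frac{p^2-1}{4}p^{e-2}+\frac{p^2-1}{4}p^{\frac e2-1}\\ \frac{(p-1)^2}{2}p^{e-2}-p^{\frac e2-1}&(p-1)p^{e-2} \end{array}$$ -/

import Mathlib

noncomputable section

/-- The number `A_w` of codewords of Hamming weight `w` in a linear code over `K` whose coordinates
are indexed by the finite type `ι` (so its length is the cardinality of `ι`). -/
def codeWeightCount {K ι : Type*} [Field K] [DecidableEq K] [Fintype ι]
    (C : Submodule K (ι → K)) (w : ℕ) : ℕ :=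
  Nat.card {c : C // hammingNorm (c : ι → K) = w}

open Classical in
/-- The number of weights `w` with `1 ≤ w ≤ n` that occur in the code, `n` being its length.
The code is a `t`-weight code when this number is `t`. -/
def numNonzeroWeights {K ι : Type*} [Field K] [DecidableEq K] [Fintype ι]
    (C : Submodule K (ι → K)) : ℕ :=
  ((Finset.Icc 1 (Fintype.card ι)).filter (fun w => codeWeightCount C w ≠ 0)).card

/-- The weight distribution of `C` is given by a table of rows `(weight, multiplicity)`.
Rows whose weights coincide are merged (their multiplicities are added), and weights which are not
in the table do not occur. -/
def HasWeightTable {K ι : Type*} [Field K] [DecidableEq K] [Fintype ι]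
    (C : Submodule K (ι → K)) (rows : List (ℚ × ℚ)) : Prop :=
  ∀ w : ℕ, (codeWeightCount C w : ℚ) =
    (rows.map (fun r => if r.1 = (w : ℚ) then r.2 else 0)).sum

/-- The cyclotomic classes of order two of `𝔽_p`: for `i = 0` the nonzero squares, for `i = 1` the
non-squares. -/
def cyclotomicClassTwo (p : ℕ) (i : Fin 2) : Set (ZMod p) :=
  if i = 0 then {c | c ≠ 0 ∧ IsSquare c} else {c | c ≠ 0 ∧ ¬ IsSquare c}

open Classical in
/-- The defining set `D_i = {x ∈ F : Tr (x ^ (p + 1) - x) ∈ C_i}`. -/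
def definingSet (p : ℕ) [Fact p.Prime] (F : Type*) [Field F] [Fintype F] [Algebra (ZMod p) F]
    (i : Fin 2) : Finset F :=
  Finset.univ.filter
    (fun x : F => Algebra.trace (ZMod p) F (x ^ (p + 1) - x) ∈ cyclotomicClassTwo p i)

/-- The map `a ↦ c(a) = (Tr (a x))_{x ∈ D}`. -/
def traceCodeword (p : ℕ) [Fact p.Prime] {F : Type*} [Field F] [Algebra (ZMod p) F]
    (D : Finset F) : F →ₗ[ZMod p] (D → ZMod p) where
  toFun a := fun x => Algebra.trace (ZMod p) F (a * (x : F))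
  map_add' a b := by
    funext x
    simp [add_mul]
  map_smul' c a := by
    funext x
    simp

/-- The linear code `{c(a) : a ∈ F}` over `𝔽_p` with defining set `D`. -/
def traceCode (p : ℕ) [Fact p.Prime] {F : Type*} [Field F] [Algebra (ZMod p) F]
    (D : Finset F) : Submodule (ZMod p) (D → ZMod p) :=
  LinearMap.range (traceCodeword p D)

/-- Weights and multiplicities for `p ≡ 1 (mod 4)`; `e` is even and `e ≥ 2`. -/
def tableOneModFour (p e : ℕ) : List (ℚ × ℚ) :=
  [(0, 1),
   (((p : ℚ) - 1) ^ 2 / 2 * (p : ℚ) ^ (e - 2),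
    (p : ℚ) ^ (e - 1) - 1),
   (((p : ℚ) - 1) ^ 2 / 2 * (p : ℚ) ^ (e - 2) + ((p : ℚ) - 1) / 2 * (p : ℚ) ^ (e / 2 - 1),
    ((p : ℚ) ^ 2 - 1) / 2 * (p : ℚ) ^ (e - 2)),
   (((p : ℚ) - 1) ^ 2 / 2 * (p : ℚ) ^ (e - 2) + ((p : ℚ) - 3) / 2 * (p : ℚ) ^ (e / 2 - 1),
    ((p : ℚ) - 1) ^ 2 / 4 * (p : ℚ) ^ (e - 2)
      - ((p : ℚ) - 1) ^ 2 / 4 * (p : ℚ) ^ (e / 2 - 1)),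
   (((p : ℚ) - 1) ^ 2 / 2 * (p : ℚ) ^ (e - 2) + ((p : ℚ) + 1) / 2 * (p : ℚ) ^ (e / 2 - 1),
    ((p : ℚ) - 1) ^ 2 / 4 * (p : ℚ) ^ (e - 2)
      + ((p : ℚ) - 1) ^ 2 / 4 * (p : ℚ) ^ (e / 2 - 1))]

/-- Weights and multiplicities for `p ≡ 3 (mod 4)`; `e` is even and `e ≥ 2`. -/
def tableThreeModFour (p e : ℕ) : List (ℚ × ℚ) :=
  [(0, 1),
   (((p : ℚ) - 1) ^ 2 / 2 * (p : ℚ) ^ (e - 2),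
    (p : ℚ) ^ (e - 2) - 1),
   (((p : ℚ) - 1) ^ 2 / 2 * (p : ℚ) ^ (e - 2) - ((p : ℚ) + 1) / 2 * (p : ℚ) ^ (e / 2 - 1),
    ((p : ℚ) ^ 2 - 1) / 2 * (p : ℚ) ^ (e - 2) - ((p : ℚ) - 1) * (p : ℚ) ^ (e / 2 - 1)),
   (((p : ℚ) - 1) ^ 2 / 2 * (p : ℚ) ^ (e - 2) - ((p : ℚ) + 3) / 2 * (p : ℚ) ^ (e / 2 - 1),
    ((p : ℚ) - 1) * ((p : ℚ) - 3) / 4 * (p : ℚ) ^ (e - 2)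
      - ((p : ℚ) - 1) * ((p : ℚ) - 3) / 4 * (p : ℚ) ^ (e / 2 - 1)),
   (((p : ℚ) - 1) ^ 2 / 2 * (p : ℚ) ^ (e - 2) - ((p : ℚ) - 1) / 2 * (p : ℚ) ^ (e / 2 - 1),
    ((p : ℚ) ^ 2 - 1) / 4 * (p : ℚ) ^ (e - 2)
      + ((p : ℚ) ^ 2 - 1) / 4 * (p : ℚ) ^ (e / 2 - 1)),
   (((p : ℚ) - 1) ^ 2 / 2 * (p : ℚ) ^ (e - 2) - (p : ℚ) ^ (e / 2 - 1),
    ((p : ℚ) - 1) * (p : ℚ) ^ (e - 2))]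

end

open Finset

/-! Write Q(x) = Tr(x^(p+1)) and L = `polarMap`, so that Q(x+b) = Q(x) + Q(b) + Tr(L(b)x). Since e ≡
2 (mod 4), Q is nondegenerate and L is bijective. Since L(1/2) = 1, the linear term can be absorbed:
the substitution x = y + 1/2 turns Tr(x^(p+1) - x) into Q(y) - e/4, so D_i is a translate of a union
of level sets of Q.

Put P = p^(e/2-1). Nonzero values of Q are equally frequent (`formCount_eq_one`), the second moment
fixes the remaining excess up to sign (`sum_formCount_sq`), and divisibility by p+1 fixes the sign:
Q is of minus type (`formCount_eq`). A double count then gives the joint law of Q and any functional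
Tr(L(b)·) in terms of the number of roots of a quadratic polynomial over 𝔽_p
(`card_form_eq_and_trace_eq`).

This law is used twice. Summed over C_i, it gives the weight of the codeword of a = L(b), b ≠ 0,
which depends only on the quadratic characters of v = eQ(b) and t² - v, t = Tr b
(`hammingNorm_traceCodeword_polarMap`); the hypothesis on (e/p) cancels the dependence on i. For b =
1/2 it shows that each (v, t) arises from P² - Pη(t² - v) elements b (`sum_signs`). The
multiplicities then follow from the count of pairs (v, t) with prescribed characters
(`sum_quadraticChar_pair`). -/

/-- The quadratic form `x ↦ Tr (x ^ (p + 1))`. -/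
noncomputable def traceNormForm (p : ℕ) [Fact p.Prime] {F : Type*} [Field F]
    [Algebra (ZMod p) F] (x : F) :
    ZMod p :=
  Algebra.trace (ZMod p) F (x ^ (p + 1))

/-- The map `b ↦ b ^ p + b ^ (p ^ (e - 1))`, which represents the polar form of `traceNormForm`. -/
def polarMap (p e : ℕ) {F : Type*} [Field F] (b : F) : F :=
  b ^ p + b ^ (p ^ (e - 1))

/-! ### The form Tr(x^(p+1)), its polarization and nondegeneracy -/

section Form

variable {p e : ℕ} [Fact p.Prime] {F : Type*} [Field F] [Algebra (ZMod p) F]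

theorem charP_of_zmod_algebra : CharP F p :=
  charP_of_injective_algebraMap (algebraMap (ZMod p) F).injective p

theorem two_ne_zero_of_zmod_algebra (hp : p ≠ 2) : (2 : F) ≠ 0 := by
  have := charP_of_zmod_algebra (p := p) (F := F)
  exact Ring.two_ne_zero (by rwa [ringChar.eq F p])

theorem traceNormForm_zero : traceNormForm p (0 : F) = 0 := by
  simp [traceNormForm]

theorem traceNormForm_mul_of_pow_eq {w : F} {c : ZMod p}
    (hw : w ^ (p + 1) = algebraMap (ZMod p) F c) (x : F) :
    traceNormForm p (w * x) = c * traceNormForm p x := by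
  rw [traceNormForm, mul_pow, hw, ← Algebra.smul_def, map_smul, smul_eq_mul, traceNormForm]

theorem traceNormForm_algebraMap_mul (c : ZMod p) (x : F) :
    traceNormForm p (algebraMap (ZMod p) F c * x) = c ^ 2 * traceNormForm p x := by
  apply traceNormForm_mul_of_pow_eq
  rw [← map_pow, pow_succ, ZMod.pow_card, sq]

theorem trace_algebraMap_mul (c : ZMod p) (x : F) :
    Algebra.trace (ZMod p) F (algebraMap (ZMod p) F c * x) = c * Algebra.trace (ZMod p) F x := by
  rw [← Algebra.smul_def, map_smul, smul_eq_mul]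

variable [Fintype F]

theorem trace_pow_char (x : F) :
    Algebra.trace (ZMod p) F (x ^ p) = Algebra.trace (ZMod p) F x := by
  have h := Algebra.trace_eq_of_algEquiv
    (FiniteField.frobeniusAlgEquivOfAlgebraic (ZMod p) F) x
  simpa [ZMod.card] using h

theorem finrank_eq_of_card (hF : Fintype.card F = p ^ e) : Module.finrank (ZMod p) F = e := by
  have h := Module.card_eq_pow_finrank (K := ZMod p) (V := F)
  rw [hF, ZMod.card] at h
  exact (Nat.pow_right_injective (Fact.out : p.Prime).two_le h).symm

omit [Fact p.Prime] [Algebra (ZMod p) F] in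
theorem pow_card_pow_self (hF : Fintype.card F = p ^ e) (x : F) : x ^ p ^ e = x := by
  rw [← hF, FiniteField.pow_card]

/-- Frobenius turns the exponent p^(e-1) into p^e, which acts trivially on F; the kernel equation
becomes b^(p²) = -b. -/
theorem polarMap_pow (he : e ≠ 0) (hF : Fintype.card F = p ^ e) (b : F) :
    polarMap p e b ^ p = b ^ p ^ 2 + b := by
  have := charP_of_zmod_algebra (p := p) (F := F)
  rw [polarMap, add_pow_char, ← pow_mul, ← pow_mul, ← pow_succ, Nat.sub_add_cancel (by omega),
    pow_card_pow_self hF, sq]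

/-- The trace is invariant under Frobenius, and b·y^p is the p-th power of b^(p^(e-1))·y. -/
theorem trace_mul_polarMap (he : e ≠ 0) (hF : Fintype.card F = p ^ e) (b y : F) :
    Algebra.trace (ZMod p) F (polarMap p e b * y)
      = Algebra.trace (ZMod p) F (b ^ p * y + b * y ^ p) := by
  have h : b * y ^ p = (b ^ p ^ (e - 1) * y) ^ p := by
    rw [mul_pow, ← pow_mul, ← pow_succ, Nat.sub_add_cancel (by omega), pow_card_pow_self hF]
  rw [map_add, h, trace_pow_char, ← map_add, polarMap, add_mul]

theorem traceNormForm_add (he : e ≠ 0) (hF : Fintype.card F = p ^ e) (x b : F) :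
    traceNormForm p (x + b) = traceNormForm p x + traceNormForm p b
      + Algebra.trace (ZMod p) F (polarMap p e b * x) := by
  have := charP_of_zmod_algebra (p := p) (F := F)
  rw [trace_mul_polarMap he hF]
  simp only [traceNormForm, ← map_add]
  congr 1
  rw [pow_succ, add_pow_char]
  ring

omit [Fintype F] in
theorem polarMap_sub (a b : F) : polarMap p e (a - b) = polarMap p e a - polarMap p e b := by
  have := charP_of_zmod_algebra (p := p) (F := F)
  rw [polarMap, sub_pow_char, sub_pow_char_pow, polarMap, polarMap]
  ring

omit [Fintype F] in
theorem polarMap_zero : polarMap p e (0 : F) = 0 := by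
  have := polarMap_sub (p := p) (e := e) (0 : F) 0
  simpa using this

/-- Iterating b^(p²) = -b exactly e/2 times gives b = b^(p^e) = (-1)^(e/2) b. Because e/2 is odd, 2b
= 0. -/
theorem polarMap_eq_zero_iff (hp : p ≠ 2) (he : e % 4 = 2) (hF : Fintype.card F = p ^ e) {b : F} :
    polarMap p e b = 0 ↔ b = 0 := by
  refine ⟨fun h => ?_, fun h => by rw [h, polarMap_zero]⟩
  have h2 : b ^ p ^ 2 = -b := by
    have := polarMap_pow (by omega) hF b
    rw [h, zero_pow (Fact.out : p.Prime).ne_zero] at this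
    exact eq_neg_of_add_eq_zero_left this.symm
  have hodd : Odd (p ^ 2) := ((Fact.out : p.Prime).odd_of_ne_two hp).pow
  have key : ∀ k : ℕ, b ^ p ^ (2 * k) = (-1) ^ k * b := by
    intro k
    induction k with
    | zero => simp
    | succ k ih =>
      rw [Nat.mul_succ, pow_add, pow_mul, ih, mul_pow, h2, ← pow_mul, mul_comm k, pow_mul,
        hodd.neg_one_pow, pow_succ]
      ring
  have h3 := key (e / 2)
  rw [Nat.mul_div_cancel' (by omega), pow_card_pow_self hF,
    (Nat.odd_iff.mpr (by omega) : Odd (e / 2)).neg_one_pow] at h3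
  have h4 : (2 : F) * b = 0 := by linear_combination h3
  exact (mul_eq_zero.mp h4).resolve_left (two_ne_zero_of_zmod_algebra hp)

theorem polarMap_bijective (hp : p ≠ 2) (he : e % 4 = 2) (hF : Fintype.card F = p ^ e) :
    Function.Bijective (polarMap p e : F → F) := by
  apply Finite.injective_iff_bijective.mp
  intro a b h
  rw [← sub_eq_zero, ← polarMap_eq_zero_iff hp he hF, polarMap_sub, h, sub_self]

-- This exhibits Tr itself as the polar pairing with 1/2, which allows completing the square and
-- applying the joint law to Tr.
omit [Fintype F] in
theorem polarMap_half (hp : p ≠ 2) : polarMap p e ((2 : F)⁻¹) = 1 := by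
  have h : ∀ n, ((2 : F)⁻¹) ^ p ^ n = 2⁻¹ := by
    intro n
    have h2 : ((2 : F)⁻¹) = algebraMap (ZMod p) F 2⁻¹ := by rw [map_inv₀, map_ofNat]
    rw [h2, ← map_pow, ZMod.pow_card_pow]
  have h1 := h 1
  rw [pow_one] at h1
  rw [polarMap, h1, h, ← two_mul, mul_inv_cancel₀ (two_ne_zero_of_zmod_algebra hp)]

theorem traceNormForm_half (hF : Fintype.card F = p ^ e) :
    traceNormForm p ((2 : F)⁻¹) = (e : ZMod p) / 4 := by
  have h2 : ((2 : F)⁻¹) = algebraMap (ZMod p) F 2⁻¹ * 1 := by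
    rw [map_inv₀, map_ofNat, mul_one]
  rw [h2, traceNormForm_algebraMap_mul, traceNormForm, one_pow, ← map_one (algebraMap (ZMod p) F),
    Algebra.trace_algebraMap, finrank_eq_of_card hF]
  simp only [nsmul_eq_mul, mul_one]
  rw [div_eq_mul_inv, mul_comm, inv_pow]
  norm_num

theorem trace_polarMap (he : e ≠ 0) (hF : Fintype.card F = p ^ e) (b : F) :
    Algebra.trace (ZMod p) F (polarMap p e b) = 2 * Algebra.trace (ZMod p) F b := by
  have := trace_mul_polarMap he hF b 1
  rw [mul_one, mul_one, one_pow, mul_one, map_add, trace_pow_char] at this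
  rw [this, two_mul]

theorem card_trace_mul_eq (hF : Fintype.card F = p ^ e) {a : F} (ha : a ≠ 0) (d : ZMod p) :
    #{y : F | Algebra.trace (ZMod p) F (a * y) = d} * p = p ^ e := by
  classical
  let f : F →+ ZMod p :=
    (Algebra.trace (ZMod p) F).toAddMonoidHom.comp (AddMonoidHom.mulLeft a)
  have hf : Function.Surjective f := by
    intro d
    obtain ⟨y, hy⟩ := Algebra.trace_surjective (ZMod p) F d
    exact ⟨a⁻¹ * y, by simpa [f, mul_inv_cancel_left₀ ha] using hy⟩
  have h := Finset.card_eq_sum_card_fiberwise (f := f) (s := univ) (t := univ) (by simp)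
  have hc : ∀ c ∈ (univ : Finset (ZMod p)), #{y : F | f y = c} = #{y : F | f y = d} :=
    fun c _ => AddMonoidHom.card_fiber_eq_of_mem_range f (hf c) (hf d)
  rw [Finset.sum_congr rfl hc, Finset.card_univ, hF, Finset.sum_const, Finset.card_univ, ZMod.card,
    smul_eq_mul, mul_comm] at h
  exact h.symm

end Form

/-! ### Value distribution of the form, alone and jointly with a linear functional -/

section Count

variable {p e : ℕ} [Fact p.Prime] {F : Type*} [Field F] [Algebra (ZMod p) F]

theorem polarMap_algebraMap_mul (c : ZMod p) (b : F) :
    polarMap p e (algebraMap (ZMod p) F c * b) = algebraMap (ZMod p) F c * polarMap p e b := by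
  rw [polarMap, mul_pow, mul_pow, ← map_pow, ← map_pow, ZMod.pow_card, ZMod.pow_card_pow, polarMap,
    mul_add]

variable [Fintype F]

/-- For even e, p² - 1 divides q - 1. If c = g^k with g a generator, then c^(p-1) = 1 forces
(p+1)(p-1) ∣ k(p-1), so k is a multiple of p+1. -/
theorem exists_pow_succ_eq_algebraMap (he : e % 4 = 2) (hF : Fintype.card F = p ^ e) {c : ZMod p}
    (hc : c ≠ 0) : ∃ w : F, w ≠ 0 ∧ w ^ (p + 1) = algebraMap (ZMod p) F c := by
  classical
  have hp2 := (Fact.out : p.Prime).two_le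
  obtain ⟨g, hg⟩ := IsCyclic.exists_generator (α := Fˣ)
  have hu : algebraMap (ZMod p) F c ≠ 0 := by simpa using hc
  obtain ⟨k, hk⟩ := (mem_powers_iff_mem_zpowers).mpr (hg (Units.mk0 _ hu))
  have hord : orderOf g = p ^ e - 1 := by
    rw [orderOf_eq_card_of_forall_mem_zpowers hg, Nat.card_eq_fintype_card, Fintype.card_units, hF]
  have h1 : g ^ (k * (p - 1)) = 1 := by
    rw [pow_mul]
    simp only at hk
    rw [hk]
    ext
    simp [← map_pow, ZMod.pow_card_sub_one_eq_one hc]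
  have h2 : (p + 1) * (p - 1) ∣ p ^ e - 1 := by
    have h := Nat.sub_dvd_pow_sub_pow (p ^ 2) 1 (e / 2)
    rw [← pow_mul, Nat.mul_div_cancel' (by omega), one_pow] at h
    have h3 := Nat.sq_sub_sq p 1
    rw [one_pow] at h3
    rwa [h3] at h
  have h3 : p + 1 ∣ k := by
    refine Nat.dvd_of_mul_dvd_mul_right (k := p - 1) (by omega) (h2.trans ?_)
    rw [← hord]
    exact orderOf_dvd_of_pow_eq_one h1
  obtain ⟨j, rfl⟩ := h3
  refine ⟨(g ^ j : Fˣ), Units.ne_zero _, ?_⟩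
  have h4 := congrArg (Units.val) hk
  simp only [Units.val_mk0] at h4
  rw [← h4, ← Units.val_pow_eq_pow_val, ← pow_mul, mul_comm]

variable (p F) in
/-- The number of `x` with `traceNormForm p x = c`. -/
noncomputable def formCount (c : ZMod p) : ℕ :=
  #{x : F | traceNormForm p x = c}

theorem formCount_eq_one (he : e % 4 = 2) (hF : Fintype.card F = p ^ e) {c : ZMod p} (hc : c ≠ 0) :
    formCount p F c = formCount p F 1 := by
  obtain ⟨w, hw0, hw⟩ := exists_pow_succ_eq_algebraMap he hF hc
  symm
  refine Finset.card_bij (fun x _ => w * x) ?_ ?_ ?_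
  · intro x hx
    simp only [mem_filter, mem_univ, true_and] at hx ⊢
    rw [traceNormForm_mul_of_pow_eq hw, hx, mul_one]
  · intro x _ y _ h
    exact mul_left_cancel₀ hw0 h
  · intro y hy
    simp only [mem_filter, mem_univ, true_and] at hy
    refine ⟨w⁻¹ * y, ?_, mul_inv_cancel_left₀ hw0 y⟩
    simp only [mem_filter, mem_univ, true_and]
    have := traceNormForm_mul_of_pow_eq hw (w⁻¹ * y)
    rw [mul_inv_cancel_left₀ hw0, hy] at this
    exact mul_left_cancel₀ hc (by rw [← this, mul_one])

theorem sum_formCount (hF : Fintype.card F = p ^ e) : ∑ c, formCount p F c = p ^ e := by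
  rw [← hF, ← Finset.card_univ]
  exact (Finset.card_eq_sum_card_fiberwise (f := traceNormForm p) (s := (univ : Finset F))
    (t := univ) (by simp)).symm

theorem formCount_zero_add (he : e % 4 = 2) (hF : Fintype.card F = p ^ e) :
    formCount p F 0 + (p - 1) * formCount p F 1 = p ^ e := by
  rw [← sum_formCount hF, ← Finset.add_sum_erase _ _ (mem_univ (0 : ZMod p)),
    Finset.sum_congr rfl (fun c hc => formCount_eq_one he hF (ne_of_mem_erase hc))]
  simp [ZMod.card]

/-- The sum of squares counts pairs (y+b, y) on which the form agrees. For b = 0 every y qualifies;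
for b ≠ 0 the condition is affine in y with nonzero linear part, leaving p^(e-1) solutions. -/
theorem sum_formCount_sq (hp : p ≠ 2) (he : e % 4 = 2) (hF : Fintype.card F = p ^ e) :
    p * ∑ c, formCount p F c ^ 2 = p * p ^ e + (p ^ e - 1) * p ^ e := by
  classical
  have h1 : ∑ c, formCount p F c ^ 2
      = #{z : F × F | traceNormForm p (z.2 + z.1) = traceNormForm p z.2} := by
    rw [Finset.card_eq_sum_card_fiberwise (f := fun z => traceNormForm p z.2) (t := univ) (by simp)]
    refine Finset.sum_congr rfl fun c _ => ?_
    rw [sq, formCount, ← Finset.card_product]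
    refine Finset.card_bij' (fun z _ => (z.1 - z.2, z.2)) (fun z _ => (z.2 + z.1, z.2)) ?_ ?_ ?_ ?_
    · rintro ⟨x, y⟩ h
      simp only [mem_product, mem_filter, mem_univ, true_and] at h ⊢
      simp [h]
    · rintro ⟨x, y⟩ h
      simp only [mem_product, mem_filter, mem_univ, true_and] at h ⊢
      simp [h]
    · rintro ⟨x, y⟩ _
      simp
    · rintro ⟨x, y⟩ _
      simp
  have h2 : #{z : F × F | traceNormForm p (z.2 + z.1) = traceNormForm p z.2}
      = ∑ b : F, #{y : F | traceNormForm p (y + b) = traceNormForm p y} := by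
    rw [Finset.card_eq_sum_card_fiberwise (f := Prod.fst) (t := univ) (by simp)]
    refine Finset.sum_congr rfl fun b _ => ?_
    refine Finset.card_bij' (fun z _ => z.2) (fun y _ => (b, y)) ?_ ?_ ?_ ?_
    · rintro ⟨x, y⟩ h
      simp only [mem_filter, mem_univ, true_and] at h ⊢
      rw [← h.2]
      exact h.1
    · intro y h
      simpa using h
    · rintro ⟨x, y⟩ h
      simp only [mem_filter, mem_univ, true_and] at h ⊢
      rw [h.2]
    · simp
  have h3 : ∀ b ∈ univ.erase (0 : F),
      p * #{y : F | traceNormForm p (y + b) = traceNormForm p y} = p ^ e := by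
    intro b hb
    have hb' : polarMap p e b ≠ 0 := (polarMap_eq_zero_iff hp he hF).not.mpr (ne_of_mem_erase hb)
    rw [mul_comm, ← card_trace_mul_eq hF hb' (-traceNormForm p b)]
    congr 3 with y
    rw [traceNormForm_add (by omega) hF]
    constructor <;> intro h <;> linear_combination h
  rw [h1, h2, ← Finset.add_sum_erase _ _ (mem_univ (0 : F)), mul_add, Finset.mul_sum,
    Finset.sum_congr rfl h3]
  simp [hF]

/-- The solutions are nonzero and form a union of fibres of u ↦ u^(p+1) on the cyclic group Fˣ, each
nonempty fibre having p+1 elements. The divisibility serves to choose the sign in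
`formCount_zero_sub`. -/
theorem succ_dvd_formCount_one (he : e % 4 = 2) (hF : Fintype.card F = p ^ e) :
    p + 1 ∣ formCount p F 1 := by
  classical
  have h1 : formCount p F 1
      = #{u : Fˣ | Algebra.trace (ZMod p) F ((powMonoidHom (p + 1) u : Fˣ) : F) = 1} := by
    rw [formCount]
    symm
    refine Finset.card_bij (fun u _ => (u : F)) ?_ ?_ ?_
    · intro u hu
      simp only [mem_filter, mem_univ, true_and] at hu ⊢
      simpa only [traceNormForm, powMonoidHom_apply, Units.val_pow_eq_pow_val] using hu
    · intro u _ v _ h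
      exact Units.ext h
    · intro x hx
      simp only [mem_filter, mem_univ, true_and] at hx
      have hx0 : x ≠ 0 := by
        rintro rfl
        rw [traceNormForm_zero] at hx
        exact zero_ne_one hx
      exact ⟨Units.mk0 x hx0, by
        simpa only [mem_filter, mem_univ, true_and, powMonoidHom_apply, Units.val_pow_eq_pow_val,
          Units.val_mk0, traceNormForm] using hx, rfl⟩
  have hker : #{u : Fˣ | powMonoidHom (p + 1) u = 1} = p + 1 := by
    have h := IsCyclic.card_powMonoidHom_ker (G := Fˣ) (p + 1)
    have hd : p + 1 ∣ Nat.card Fˣ := by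
      rw [Nat.card_eq_fintype_card, Fintype.card_units, hF]
      have h := Nat.sub_dvd_pow_sub_pow (p ^ 2) 1 (e / 2)
      rw [← pow_mul, Nat.mul_div_cancel' (by omega), one_pow] at h
      have h3 := Nat.sq_sub_sq p 1
      rw [one_pow] at h3
      rw [h3] at h
      exact (dvd_mul_right _ _).trans h
    rw [Nat.gcd_eq_right hd] at h
    rw [Nat.card_eq_fintype_card, Fintype.card_subtype] at h
    simp only [MonoidHom.mem_ker] at h
    convert h
  rw [h1, Finset.card_eq_sum_card_fiberwise (f := powMonoidHom (p + 1)) (t := univ) (by simp)]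
  refine Finset.dvd_sum fun v _ => ?_
  rw [Finset.filter_filter]
  by_cases hv : Algebra.trace (ZMod p) F (v : F) = 1 ∧ v ∈ Set.range (powMonoidHom (α := Fˣ) (p + 1))
  · have : ∀ u : Fˣ, (Algebra.trace (ZMod p) F ((powMonoidHom (p + 1) u : Fˣ) : F) = 1
        ∧ powMonoidHom (p + 1) u = v) ↔ powMonoidHom (p + 1) u = v :=
      fun u => ⟨fun h => h.2, fun h => ⟨by rw [h]; exact hv.1, h⟩⟩
    simp only [this]
    rw [MonoidHom.card_fiber_eq_of_mem_range _ hv.2 ⟨1, map_one _⟩, hker]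
  · rw [Finset.filter_false_of_mem]
    · simp
    · rintro u - ⟨h, h'⟩
      exact hv ⟨by rw [← h', h], u, h'⟩

theorem pow_eq_mul_sq {p e : ℕ} (he : e % 4 = 2) : p ^ e = p ^ 2 * (p ^ (e / 2 - 1)) ^ 2 := by
  rw [← pow_mul, ← pow_add]
  congr 1
  omega

theorem formCount_zero_sub (hp : p ≠ 2) (he : e % 4 = 2) (hF : Fintype.card F = p ^ e) :
    (formCount p F 0 : ℤ) - formCount p F 1 = -(p * p ^ (e / 2 - 1)) := by
  have hp1 := (Fact.out : p.Prime).one_le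
  have hq := pow_eq_mul_sq (p := p) he
  have hqpos : 1 ≤ p ^ e := Nat.one_le_pow _ _ hp1
  have h1 : (formCount p F 0 : ℤ) + (p - 1) * formCount p F 1 = p ^ e := by
    have := formCount_zero_add (F := F) he hF
    zify [hp1] at this
    exact this
  have h2 : (p : ℤ) * ((formCount p F 0 : ℤ) ^ 2 + (p - 1) * (formCount p F 1 : ℤ) ^ 2)
      = p * p ^ e + (p ^ e - 1) * p ^ e := by
    have := sum_formCount_sq (F := F) hp he hF
    rw [← Finset.add_sum_erase _ _ (mem_univ (0 : ZMod p)),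
      Finset.sum_congr rfl (fun c hc => by rw [formCount_eq_one he hF (ne_of_mem_erase hc)])] at this
    simp only [sum_const, mem_univ, card_erase_of_mem, card_univ, ZMod.card, smul_eq_mul] at this
    zify [hp1, hqpos] at this
    exact this
  have hqz : (p : ℤ) ^ e = p ^ 2 * (p ^ (e / 2 - 1)) ^ 2 := by exact_mod_cast hq
  have hdvd : ((p : ℤ) + 1) ∣ formCount p F 1 := by
    exact_mod_cast succ_dvd_formCount_one (F := F) he hF
  have hmod : (p : ℤ) ≡ -1 [ZMOD (p + 1)] := (Int.modEq_iff_dvd).mpr ⟨-1, by ring⟩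
  have hPmod : (p : ℤ) ^ (e / 2 - 1) ≡ 1 [ZMOD (p + 1)] := by
    have := hmod.pow (e / 2 - 1)
    rwa [(Nat.even_iff.mpr (by omega) : Even (e / 2 - 1)).neg_one_pow] at this
  generalize (p : ℤ) ^ (e / 2 - 1) = P at *
  generalize (formCount p F 0 : ℤ) = A at *
  generalize (formCount p F 1 : ℤ) = B at *
  rw [hqz] at h1 h2
  have hp0 : (p : ℤ) - 1 ≠ 0 := by
    have := (Fact.out : p.Prime).two_le
    omega
  have hS : (A - B) ^ 2 = (p * P) ^ 2 := by
    apply mul_left_cancel₀ hp0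
    have hA : A = p ^ 2 * P ^ 2 - (p - 1) * B := by linarith
    subst hA
    linear_combination h2
  rcases sq_eq_sq_iff_eq_or_eq_neg.mp hS with h | h
  -- The plus sign would give pB = p²P² - pP. Modulo p+1 one has p ≡ -1, P ≡ 1 (as e/2 - 1 is even)
  -- and B ≡ 0, so this would read 0 ≡ 2.
  · exfalso
    have h3 : (p : ℤ) * B = p ^ 2 * P ^ 2 - p * P := by linear_combination h1 - h
    have h4 : (0 : ℤ) ≡ 2 [ZMOD (p + 1)] := by
      have h5 : (p : ℤ) * B ≡ 0 [ZMOD (p + 1)] :=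
        (Int.modEq_zero_iff_dvd).mpr (hdvd.mul_left _)
      have h6 := ((hmod.pow 2).mul (hPmod.pow 2)).sub (hmod.mul hPmod)
      rw [← h3] at h6
      exact (h5.symm.trans h6).trans (by norm_num)
    have h7 := Int.le_of_dvd (by norm_num) ((Int.modEq_iff_dvd).mp h4)
    have := (Fact.out : p.Prime).two_le
    omega
  · exact h

/-- The value distribution of `traceNormForm`, which is a quadratic form of minus type. -/
theorem formCount_eq (hp : p ≠ 2) (he : e % 4 = 2) (hF : Fintype.card F = p ^ e) (c : ZMod p) :
    (formCount p F c : ℤ) = p * (p ^ (e / 2 - 1)) ^ 2 + p ^ (e / 2 - 1)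
      - if c = 0 then (p : ℤ) * p ^ (e / 2 - 1) else 0 := by
  have hp1 := (Fact.out : p.Prime).one_le
  have hS := formCount_zero_sub (F := F) hp he hF
  have h1 : (formCount p F 0 : ℤ) + (p - 1) * formCount p F 1 = p ^ e := by
    have := formCount_zero_add (F := F) he hF
    zify [hp1] at this
    exact this
  have hqz : (p : ℤ) ^ e = p ^ 2 * (p ^ (e / 2 - 1)) ^ 2 := by
    exact_mod_cast pow_eq_mul_sq (p := p) he
  have hp0 : (p : ℤ) ≠ 0 := by omega
  have hone : (formCount p F 1 : ℤ) = p * (p ^ (e / 2 - 1)) ^ 2 + p ^ (e / 2 - 1) := by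
    apply mul_left_cancel₀ hp0
    linear_combination h1 - hS + hqz
  split_ifs with hc
  · rw [hc]
    linear_combination hS + hone
  · rw [formCount_eq_one he hF hc, hone, sub_zero]

theorem card_affine_eq_zero (A l : ZMod p) :
    (#{u : ZMod p | A + u * l = 0} : ℤ) =
      if l = 0 then (if A = 0 then (p : ℤ) else 0) else 1 := by
  by_cases hl : l = 0
  · subst hl
    by_cases hA : A = 0
    · simp [hA, ZMod.card]
    · simp [hA]
  · rw [if_neg hl]
    have : #{u : ZMod p | A + u * l = 0} = 1 := by
      rw [Finset.card_eq_one]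
      refine ⟨-A / l, ?_⟩
      ext u
      simp only [mem_filter, mem_univ, true_and, mem_singleton, eq_div_iff hl]
      constructor <;> intro h <;> linear_combination h
    exact_mod_cast this

/-- The joint distribution of `traceNormForm` and a nonzero linear functional. -/
theorem card_form_eq_and_trace_eq (hp : p ≠ 2) (he : e % 4 = 2) (hF : Fintype.card F = p ^ e)
    {b : F} (hb : b ≠ 0) (c d : ZMod p) :
    (#{y : F | traceNormForm p y = c ∧ Algebra.trace (ZMod p) F (polarMap p e b * y) = d} : ℤ)
      = (p ^ (e / 2 - 1)) ^ 2 - p ^ (e / 2 - 1)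
        * (#{u : ZMod p | c + d * u + traceNormForm p b * u ^ 2 = 0} - 1) := by
  classical
  have hp0 : (p : ℤ) ≠ 0 := by exact_mod_cast (Fact.out : p.Prime).ne_zero
  have hqz : (p : ℤ) ^ e = p ^ 2 * (p ^ (e / 2 - 1)) ^ 2 := by
    exact_mod_cast pow_eq_mul_sq (p := p) he
  have ha : polarMap p e b ≠ 0 := (polarMap_eq_zero_iff hp he hF).not.mpr hb
  have hd : (#{y : F | Algebra.trace (ZMod p) F (polarMap p e b * y) = d} : ℤ) * p = p ^ e := by
    exact_mod_cast card_trace_mul_eq hF ha d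
  set l : F → ZMod p := fun y => Algebra.trace (ZMod p) F (polarMap p e b * y) - d with hl
  -- Pairs (y, u) with Q(y) - c + u·l(y) = 0 are counted in two ways. A fixed y has one u if l(y) ≠
  -- 0; if l(y) = 0 it has p or none, according as Q(y) = c or not.
  have hswap := Finset.sum_card_bipartiteAbove_eq_sum_card_bipartiteBelow
    (s := (univ : Finset F)) (t := (univ : Finset (ZMod p)))
    (fun y u => traceNormForm p y - c + u * l y = 0)
  simp only [bipartiteAbove, bipartiteBelow] at hswap
  have hL : (∑ y : F, #{u : ZMod p | traceNormForm p y - c + u * l y = 0} : ℤ)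
      = p ^ e - #{y : F | Algebra.trace (ZMod p) F (polarMap p e b * y) = d}
        + p * #{y : F | traceNormForm p y = c
            ∧ Algebra.trace (ZMod p) F (polarMap p e b * y) = d} := by
    simp only [card_affine_eq_zero]
    have : ∀ y : F, (if l y = 0 then (if traceNormForm p y - c = 0 then (p : ℤ) else 0) else 1)
        = 1 - (if Algebra.trace (ZMod p) F (polarMap p e b * y) = d then 1 else 0)
          + p * (if traceNormForm p y = c
            ∧ Algebra.trace (ZMod p) F (polarMap p e b * y) = d then 1 else 0) := by
      intro y
      simp only [hl, sub_eq_zero]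
      split_ifs <;> first | (exfalso; tauto) | ring
    rw [Finset.sum_congr rfl (fun y _ => this y), Finset.sum_add_distrib, Finset.sum_sub_distrib,
      ← Finset.mul_sum, Finset.sum_boole, Finset.sum_boole]
    simp [hF]
  -- For fixed u, completing the square gives Q(y) - c + u·l(y) = Q(y + ub) - (c + du + Q(b)u²), so
  -- the value distribution of Q applies.
  have hR : (∑ u : ZMod p, #{y : F | traceNormForm p y - c + u * l y = 0} : ℤ)
      = p * (p * (p ^ (e / 2 - 1)) ^ 2 + p ^ (e / 2 - 1))
        - p * p ^ (e / 2 - 1) * #{u : ZMod p | c + d * u + traceNormForm p b * u ^ 2 = 0} := by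
    have : ∀ u : ZMod p, #{y : F | traceNormForm p y - c + u * l y = 0}
        = formCount p F (c + d * u + traceNormForm p b * u ^ 2) := by
      intro u
      refine Finset.card_equiv (Equiv.addRight (algebraMap (ZMod p) F u * b)) fun y => ?_
      simp only [mem_filter, mem_univ, true_and, Equiv.coe_addRight]
      rw [traceNormForm_add (by omega) hF, traceNormForm_algebraMap_mul, polarMap_algebraMap_mul,
        mul_assoc, trace_algebraMap_mul]
      simp only [hl]
      constructor <;> intro h <;> linear_combination h
    simp only [this, formCount_eq hp he hF]
    rw [Finset.sum_sub_distrib, Finset.sum_ite, Finset.sum_const_zero, Finset.sum_const,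
      Finset.sum_const, Finset.card_univ, ZMod.card]
    simp only [nsmul_eq_mul, add_zero]
    ring
  have key := hL.symm.trans ((by exact_mod_cast hswap : (_ : ℤ) = _).trans hR)
  apply mul_left_cancel₀ hp0
  apply mul_left_cancel₀ hp0
  linear_combination (p : ℤ) * key + hd + (1 - p) * hqz

end Count

/-! ### Character sums and sign counts over 𝔽_p -/

theorem two_mul_card_eq_of_sign {ι : Type*} [Fintype ι] (f : ι → ℤ)
    (hf : ∀ i, f i = 0 ∨ f i = 1 ∨ f i = -1) {s : ℤ} (hs : s = 1 ∨ s = -1) :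
    2 * (#{i | f i = s} : ℤ) = ∑ i, f i ^ 2 + s * ∑ i, f i := by
  rw [← Finset.sum_boole, Finset.mul_sum, Finset.mul_sum, ← Finset.sum_add_distrib]
  -- The identity is pointwise: for f in {0, 1, -1}, twice the indicator of f = s is f² + s·f.
  refine Finset.sum_congr rfl fun i _ => ?_
  rcases hf i with h | h | h <;> rcases hs with rfl | rfl <;> simp [h]

theorem sum_comp_sign {ι : Type*} [Fintype ι] (f : ι → ℤ)
    (hf : ∀ i, f i = 0 ∨ f i = 1 ∨ f i = -1) (h : ℤ → ℚ) :
    ∑ i, h (f i) = #{i | f i = 0} * h 0 + #{i | f i = 1} * h 1 + #{i | f i = -1} * h (-1) := by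
  simp only [← Finset.sum_boole, Finset.sum_mul, ← Finset.sum_add_distrib]
  refine Finset.sum_congr rfl fun i _ => ?_
  rcases hf i with h | h | h <;> simp [h]

section QuadraticChar

variable {p : ℕ} [Fact p.Prime]

theorem quadraticChar_trichotomy (a : ZMod p) :
    quadraticChar (ZMod p) a = 0 ∨ quadraticChar (ZMod p) a = 1 ∨ quadraticChar (ZMod p) a = -1 :=
  quadraticChar_isQuadratic (ZMod p) a

theorem ringChar_zmod_ne_two (hp : p ≠ 2) : ringChar (ZMod p) ≠ 2 := by
  rwa [ZMod.ringChar_zmod_n]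

theorem quadraticChar_mul_sq {b : ZMod p} (hb : b ≠ 0) (a : ZMod p) :
    quadraticChar (ZMod p) (a * b ^ 2) = quadraticChar (ZMod p) a := by
  rw [map_mul, quadraticChar_sq_one' hb, mul_one]

theorem quadraticChar_sq_eq (a : ZMod p) :
    quadraticChar (ZMod p) a ^ 2 = 1 - if a = 0 then 1 else 0 := by
  split_ifs with h
  · simp [h]
  · rw [quadraticChar_sq_one h, sub_zero]

theorem card_sq_eq (hp : p ≠ 2) (a : ZMod p) :
    (#{t : ZMod p | t ^ 2 = a} : ℤ) = quadraticChar (ZMod p) a + 1 := by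
  rw [← quadraticChar_card_sqrts (ringChar_zmod_ne_two hp) a]
  congr 2
  ext t
  simp

theorem sum_quadraticChar_sq (p : ℕ) [Fact p.Prime] :
    ∑ a : ZMod p, quadraticChar (ZMod p) a ^ 2 = (p : ℤ) - 1 := by
  simp only [quadraticChar_sq_eq]
  simp [ZMod.card]

theorem two_mul_card_quadraticChar_eq (hp : p ≠ 2) {s : ℤ} (hs : s = 1 ∨ s = -1) :
    2 * (#{a : ZMod p | quadraticChar (ZMod p) a = s} : ℤ) = p - 1 := by
  rw [two_mul_card_eq_of_sign _ quadraticChar_trichotomy hs,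
    quadraticChar_sum_zero (ringChar_zmod_ne_two hp), sum_quadraticChar_sq]
  ring

/-- For y ≠ 0, dividing by y² replaces y(y - v) by 1 - v/y, which runs over all elements other than
1. The full character sum vanishes, so -η(1) remains. -/
theorem sum_quadraticChar_mul_sub {v : ZMod p} (hp : p ≠ 2) (hv : v ≠ 0) :
    ∑ y : ZMod p, quadraticChar (ZMod p) (y * (y - v)) = -1 := by
  have h0 := quadraticChar_sum_zero (ringChar_zmod_ne_two hp)
  rw [← Finset.add_sum_erase _ _ (mem_univ (1 : ZMod p)), map_one] at h0
  rw [← Finset.add_sum_erase _ _ (mem_univ (0 : ZMod p)), zero_mul, quadraticChar_zero, zero_add,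
    ← eq_neg_of_add_eq_zero_right h0]
  refine Finset.sum_bij' (fun y _ => 1 - v / y) (fun z _ => v / (1 - z)) ?_ ?_ ?_ ?_ ?_
  · intro y hy
    simpa [hv] using hy
  · intro z hz
    have hz : z ≠ 1 := by simpa using hz
    simpa [hv, sub_eq_zero] using hz.symm
  · intro y hy
    rw [sub_sub_cancel, div_div_cancel₀ hv]
  · intro z hz
    have hz : z ≠ 1 := by simpa using hz
    rw [div_div_cancel₀ hv, sub_sub_cancel]
  · intro y hy
    have hy : y ≠ 0 := by simpa using hy
    rw [← quadraticChar_mul_sq hy (1 - v / y)]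
    congr 1
    field_simp

theorem sum_quadraticChar_sq_sub (hp : p ≠ 2) (v : ZMod p) :
    ∑ t : ZMod p, quadraticChar (ZMod p) (t ^ 2 - v) = if v = 0 then (p : ℤ) - 1 else -1 := by
  split_ifs with hv
  · simp only [hv, sub_zero, map_pow, sum_quadraticChar_sq]
  -- Grouping by y = t² weights each y by its number of square roots, η(y) + 1.
  · have h1 : ∑ t : ZMod p, quadraticChar (ZMod p) (t ^ 2 - v)
        = ∑ y : ZMod p, (quadraticChar (ZMod p) y + 1) * quadraticChar (ZMod p) (y - v) := by
      rw [← Finset.sum_fiberwise (s := univ) (g := fun t : ZMod p => t ^ 2)]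
      refine Finset.sum_congr rfl fun y _ => ?_
      rw [← card_sq_eq hp, ← nsmul_eq_mul, ← Finset.sum_const]
      exact Finset.sum_congr rfl fun t ht => by rw [(mem_filter.mp ht).2]
    have h2 : ∑ y : ZMod p, quadraticChar (ZMod p) (y - v) = 0 := by
      rw [← quadraticChar_sum_zero (ringChar_zmod_ne_two hp)]
      exact Fintype.sum_equiv (Equiv.subRight v) _ _ fun _ => rfl
    rw [h1]
    simp only [add_mul, one_mul, Finset.sum_add_distrib, ← map_mul]
    rw [h2, sum_quadraticChar_mul_sub hp hv, add_zero]

theorem card_quadraticChar_sq_sub_eq_zero (hp : p ≠ 2) (a : ZMod p) :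
    (#{y : ZMod p | quadraticChar (ZMod p) (y ^ 2 - a) = 0} : ℤ)
      = quadraticChar (ZMod p) a + 1 := by
  simp only [quadraticChar_eq_zero_iff, sub_eq_zero]
  exact card_sq_eq hp a

theorem two_mul_card_quadraticChar_sq_sub_eq (hp : p ≠ 2) (a : ZMod p) {s : ℤ}
    (hs : s = 1 ∨ s = -1) :
    2 * (#{y : ZMod p | quadraticChar (ZMod p) (y ^ 2 - a) = s} : ℤ)
      = p - 1 - quadraticChar (ZMod p) a + s * if a = 0 then (p : ℤ) - 1 else -1 := by
  rw [two_mul_card_eq_of_sign _ (fun y => quadraticChar_trichotomy (y ^ 2 - a)) hs,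
    sum_quadraticChar_sq_sub hp]
  simp only [quadraticChar_sq_eq, sub_eq_zero, Finset.sum_sub_distrib, Finset.sum_boole,
    card_sq_eq hp]
  simp [ZMod.card]
  ring

/-- The joint distribution of the quadratic characters of `v` and `t ^ 2 - v`. -/
theorem sum_quadraticChar_pair (hp : p ≠ 2) (g : ℤ → ℤ → ℚ) :
    ∑ v : ZMod p, ∑ t : ZMod p, g (quadraticChar (ZMod p) v) (quadraticChar (ZMod p) (t ^ 2 - v))
      = g 0 0 + (p - 1) * g 0 1 + (p - 1) * g 1 0
        + (p - 1) * (p - 3) / 4 * g 1 1 + (p - 1) ^ 2 / 4 * g 1 (-1)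
        + (p - 1) ^ 2 / 4 * g (-1) 1 + (p - 1) * (p + 1) / 4 * g (-1) (-1) := by
  have hz : ∀ v : ZMod p, (#{t : ZMod p | quadraticChar (ZMod p) (t ^ 2 - v) = 0} : ℚ)
      = quadraticChar (ZMod p) v + 1 := fun v => by
    exact_mod_cast card_quadraticChar_sq_sub_eq_zero hp v
  have hs : ∀ (v : ZMod p) (s : ℤ), (s = 1 ∨ s = -1) →
      (#{t : ZMod p | quadraticChar (ZMod p) (t ^ 2 - v) = s} : ℚ)
      = (p - 1 - quadraticChar (ZMod p) v
        + s * if quadraticChar (ZMod p) v = 0 then (p : ℚ) - 1 else -1) / 2 := fun v s h => by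
    rw [eq_div_iff two_ne_zero, mul_comm]
    simp only [quadraticChar_eq_zero_iff]
    exact_mod_cast two_mul_card_quadraticChar_sq_sub_eq hp v h
  -- The inner distribution over t depends on v only through η(v), so the outer sum again runs over
  -- three signs.
  have h1 : ∀ v : ZMod p,
      ∑ t : ZMod p, g (quadraticChar (ZMod p) v) (quadraticChar (ZMod p) (t ^ 2 - v))
      = (fun x : ℤ => ((x : ℚ) + 1) * g x 0
        + (p - 1 - x + (1 : ℤ) * if x = 0 then (p : ℚ) - 1 else -1) / 2 * g x 1
        + (p - 1 - x + (-1 : ℤ) * if x = 0 then (p : ℚ) - 1 else -1) / 2 * g x (-1))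
        (quadraticChar (ZMod p) v) := fun v => by
    rw [sum_comp_sign (fun t => quadraticChar (ZMod p) (t ^ 2 - v))
      (fun t => quadraticChar_trichotomy _), hz, hs v 1 (Or.inl rfl), hs v (-1) (Or.inr rfl)]
  rw [Finset.sum_congr rfl fun v _ => h1 v, sum_comp_sign (fun v => quadraticChar (ZMod p) v) quadraticChar_trichotomy
      (fun x : ℤ => ((x : ℚ) + 1) * g x 0
        + (p - 1 - x + (1 : ℤ) * if x = 0 then (p : ℚ) - 1 else -1) / 2 * g x 1
        + (p - 1 - x + (-1 : ℤ) * if x = 0 then (p : ℚ) - 1 else -1) / 2 * g x (-1))]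
  have hc : ∀ s : ℤ, (s = 1 ∨ s = -1) →
      (#{a : ZMod p | quadraticChar (ZMod p) a = s} : ℚ) = (p - 1) / 2 := fun s h => by
    rw [eq_div_iff two_ne_zero, mul_comm]
    exact_mod_cast two_mul_card_quadraticChar_eq hp h
  have hc0 : (#{a : ZMod p | quadraticChar (ZMod p) a = 0} : ℚ) = 1 := by
    simp only [quadraticChar_eq_zero_iff]
    norm_num [Finset.filter_eq']
  rw [hc0, hc 1 (Or.inl rfl), hc (-1) (Or.inr rfl)]
  norm_num
  ring

/-- Inverting w ≠ 0 reverses the polynomial up to a square factor, making it monic even when v = 0;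
translation by t then completes the square. The two indicators correct for the excluded points,
where the values are 1 and v. -/
theorem card_quadraticChar_quadratic_eq (v t : ZMod p) (s : ℤ) :
    (#{w : ZMod p | quadraticChar (ZMod p) (1 - 2 * t * w + v * w ^ 2) = s} : ℤ)
      = (if s = 1 then 1 else 0) - (if quadraticChar (ZMod p) v = s then 1 else 0)
        + #{y : ZMod p | quadraticChar (ZMod p) (y ^ 2 - (t ^ 2 - v)) = s} := by
  have h1 : #{y : ZMod p | quadraticChar (ZMod p) (y ^ 2 - (t ^ 2 - v)) = s}
      = #{z : ZMod p | quadraticChar (ZMod p) (z ^ 2 - 2 * t * z + v) = s} := by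
    refine Finset.card_equiv (Equiv.addRight t) fun y => ?_
    simp only [mem_filter, mem_univ, true_and, Equiv.coe_addRight]
    ring_nf
  rw [h1, ← Finset.sum_boole, ← Finset.sum_boole,
    ← Finset.add_sum_erase _ _ (mem_univ (0 : ZMod p)),
    ← Finset.add_sum_erase (f := fun z : ZMod p =>
      if quadraticChar (ZMod p) (z ^ 2 - 2 * t * z + v) = s then (1 : ℤ) else 0) _
      (mem_univ (0 : ZMod p))]
  have h2 : ∑ w ∈ univ.erase (0 : ZMod p),
        (if quadraticChar (ZMod p) (1 - 2 * t * w + v * w ^ 2) = s then (1 : ℤ) else 0)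
      = ∑ z ∈ univ.erase (0 : ZMod p),
        (if quadraticChar (ZMod p) (z ^ 2 - 2 * t * z + v) = s then (1 : ℤ) else 0) := by
    refine Finset.sum_bij' (fun w _ => w⁻¹) (fun w _ => w⁻¹) ?_ ?_ ?_ ?_ ?_
    · simp
    · simp
    · simp
    · simp
    · intro w hw
      have hw : w ≠ 0 := by simpa using hw
      rw [← quadraticChar_mul_sq hw (w⁻¹ ^ 2 - 2 * t * w⁻¹ + v)]
      have : (w⁻¹ ^ 2 - 2 * t * w⁻¹ + v) * w ^ 2 = 1 - 2 * t * w + v * w ^ 2 := by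
        field_simp
      rw [this]
  have h3 : (1 : ZMod p) - 2 * t * 0 + v * 0 ^ 2 = 1 := by ring
  have h4 : (0 : ZMod p) ^ 2 - 2 * t * 0 + v = v := by ring
  rw [h2, h3, h4, map_one]
  simp only [eq_comm (a := (1 : ℤ))]
  ring

end QuadraticChar

/-! ### Length of the code and weight of a codeword -/

theorem mem_cyclotomicClassTwo_iff {p : ℕ} [Fact p.Prime] (i : Fin 2) (c : ZMod p) :
    c ∈ cyclotomicClassTwo p i ↔ quadraticChar (ZMod p) c = (-1) ^ (i : ℕ) := by
  by_cases hc : c = 0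
  · subst hc
    fin_cases i <;> simp [cyclotomicClassTwo]
  · fin_cases i
    · simp only [cyclotomicClassTwo, Fin.zero_eta, if_true, Set.mem_ofPred_eq, pow_zero]
      rw [quadraticChar_one_iff_isSquare hc]
      exact and_iff_right hc
    · simp only [cyclotomicClassTwo, Fin.mk_one, one_ne_zero, if_false, Set.mem_ofPred_eq,
        pow_one]
      rw [quadraticChar_neg_one_iff_not_isSquare]
      exact and_iff_right hc

section Weight

variable {p e : ℕ} [Fact p.Prime] {F : Type*} [Field F] [Algebra (ZMod p) F] [Fintype F]

theorem trace_half (hF : Fintype.card F = p ^ e) :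
    Algebra.trace (ZMod p) F ((2 : F)⁻¹) = (e : ZMod p) / 2 := by
  have h2 : ((2 : F)⁻¹) = algebraMap (ZMod p) F 2⁻¹ := by rw [map_inv₀, map_ofNat]
  rw [h2, Algebra.trace_algebraMap, finrank_eq_of_card hF, nsmul_eq_mul, div_eq_mul_inv]

theorem four_ne_zero_zmod (hp : p ≠ 2) : (4 : ZMod p) ≠ 0 := by
  have h2 : (2 : ZMod p) ≠ 0 := two_ne_zero_of_zmod_algebra (F := ZMod p) hp
  have : (4 : ZMod p) = 2 * 2 := by norm_num
  rw [this]
  exact mul_ne_zero h2 h2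

/-- The polar term at 1/2 is Tr(y), which cancels the linear part; the constant is e/4 - e/2. -/
theorem trace_pow_succ_sub_add_half (hp : p ≠ 2) (he : e ≠ 0) (hF : Fintype.card F = p ^ e)
    (y : F) :
    Algebra.trace (ZMod p) F ((y + 2⁻¹) ^ (p + 1) - (y + 2⁻¹)) = traceNormForm p y - e / 4 := by
  have h2 : (2 : ZMod p) ≠ 0 := two_ne_zero_of_zmod_algebra (F := ZMod p) hp
  have h4 : (4 : ZMod p) ≠ 0 := four_ne_zero_zmod hp
  have h := traceNormForm_add he hF y ((2 : F)⁻¹)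
  rw [polarMap_half hp, one_mul, traceNormForm_half hF] at h
  rw [map_sub, map_add, trace_half hF]
  change traceNormForm p (y + 2⁻¹) - _ = _
  rw [h]
  have : (e : ZMod p) / 2 = e / 4 + e / 4 := by
    field_simp
    ring
  rw [this]
  ring

theorem mem_definingSet_add_half_iff (hp : p ≠ 2) (he : e ≠ 0) (hF : Fintype.card F = p ^ e)
    (i : Fin 2) (y : F) :
    y + 2⁻¹ ∈ definingSet p F i ↔
      quadraticChar (ZMod p) (traceNormForm p y - e / 4) = (-1) ^ (i : ℕ) := by
  simp only [definingSet, mem_filter, mem_univ, true_and, mem_cyclotomicClassTwo_iff,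
    trace_pow_succ_sub_add_half hp he hF]

theorem two_mul_card_definingSet (hp : p ≠ 2) (he : e % 4 = 2) (hF : Fintype.card F = p ^ e)
    (i : Fin 2) (hi : quadraticChar (ZMod p) (e : ZMod p) = -(-1) ^ (i : ℕ)) :
    2 * ((definingSet p F i).card : ℤ)
      = (p - 1) * (p * (p ^ (e / 2 - 1)) ^ 2 + p ^ (e / 2 - 1))
        - 2 * (if quadraticChar (ZMod p) (-1) = -1 then 1 else 0) * (p * p ^ (e / 2 - 1)) := by
  classical
  have h4 : (4 : ZMod p) ≠ 0 := four_ne_zero_zmod hp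
  have hσ : ((-1) ^ (i : ℕ) : ℤ) = 1 ∨ ((-1) ^ (i : ℕ) : ℤ) = -1 := neg_one_pow_eq_or ℤ _
  have h1 : #(definingSet p F i)
      = #{y : F | quadraticChar (ZMod p) (traceNormForm p y - e / 4) = (-1) ^ (i : ℕ)} := by
    symm
    refine Finset.card_equiv (Equiv.addRight (2⁻¹ : F)) fun y => ?_
    rw [Equiv.coe_addRight, mem_definingSet_add_half_iff hp (by omega) hF, mem_filter]
    exact and_iff_right (mem_univ _)
  have h2 : #{y : F | quadraticChar (ZMod p) (traceNormForm p y - e / 4) = (-1) ^ (i : ℕ)}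
      = ∑ c : ZMod p with quadraticChar (ZMod p) c = (-1) ^ (i : ℕ), formCount p F (c + e / 4) := by
    rw [Finset.card_eq_sum_card_fiberwise (f := fun y : F => traceNormForm p y - e / 4)
      (t := ({c | quadraticChar (ZMod p) c = (-1) ^ (i : ℕ)} : Finset (ZMod p)))]
    · refine Finset.sum_congr rfl fun c hc => ?_
      rw [formCount, Finset.filter_filter]
      congr 1
      ext y
      simp only [mem_filter, mem_univ, true_and, sub_eq_iff_eq_add] at hc ⊢
      refine ⟨fun h => h.2, fun h => ⟨?_, h⟩⟩
      rw [h, add_sub_cancel_right, hc]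
    · intro y hy
      simpa only [coe_filter, mem_univ, true_and, Set.mem_ofPred_eq] using hy
  rw [h1, h2]
  push_cast
  simp only [formCount_eq hp he hF]
  rw [Finset.sum_sub_distrib, Finset.sum_const, nsmul_eq_mul, Finset.sum_filter]
  -- Only c = -e/4 meets the exceptional value 0 of the form. As η(e) = -(-1)^i, this c lies in C_i
  -- exactly when η(-1) = -1.
  have h3 : ∀ c : ZMod p, (if quadraticChar (ZMod p) c = (-1) ^ (i : ℕ) then
      (if c + (e : ZMod p) / 4 = 0 then (p : ℤ) * p ^ (e / 2 - 1) else 0) else 0)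
      = if c = -(e / 4) then (if quadraticChar (ZMod p) (-1) = -1
        then (p : ℤ) * p ^ (e / 2 - 1) else 0) else 0 := by
    intro c
    by_cases hc : c = -(e / 4)
    · have h5 : quadraticChar (ZMod p) c
          = quadraticChar (ZMod p) (-1) * -(-1) ^ (i : ℕ) := by
        have h2 : (2 : ZMod p) ≠ 0 := two_ne_zero_of_zmod_algebra (F := ZMod p) hp
        rw [← quadraticChar_mul_sq h2, hc, ← hi, ← map_mul]
        congr 1
        field_simp
        norm_num
      rw [h5, if_pos hc, hc, neg_add_cancel, if_pos rfl]
      congr 1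
      rcases hσ with h | h <;> rw [h] <;> simp only [eq_iff_iff] <;> constructor <;> intro _ <;> omega
    · have : c + (e : ZMod p) / 4 ≠ 0 := fun h => hc (eq_neg_of_add_eq_zero_left h)
      simp [hc, this]
  rw [Finset.sum_congr rfl fun c _ => h3 c, Finset.sum_ite_eq' univ, if_pos (mem_univ _)]
  have hc := two_mul_card_quadraticChar_eq hp hσ
  split_ifs <;> linear_combination
    ((p : ℤ) * (p ^ (e / 2 - 1)) ^ 2 + p ^ (e / 2 - 1)) * hc

/-- Substituting u = (e/2)w extracts the factor -e/4, of character -s·η(-1). The sign s cancels, so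
the count no longer depends on i. -/
theorem card_quadraticChar_shifted_eq (hp : p ≠ 2) (he : (e : ZMod p) ≠ 0) {s : ℤ}
    (hs : s = 1 ∨ s = -1) (hi : quadraticChar (ZMod p) (e : ZMod p) = -s) (β t : ZMod p) :
    (#{u : ZMod p | quadraticChar (ZMod p) (-(e / 4 - t * u + β * u ^ 2)) = s} : ℤ)
      = #{w : ZMod p | quadraticChar (ZMod p) (1 - 2 * t * w + e * β * w ^ 2)
          = -quadraticChar (ZMod p) (-1)} := by
  have h2 : (2 : ZMod p) ≠ 0 := two_ne_zero_of_zmod_algebra (F := ZMod p) hp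
  have h4 : (4 : ZMod p) ≠ 0 := four_ne_zero_zmod hp
  have h0 : (e : ZMod p) / 2 ≠ 0 := div_ne_zero he h2
  congr 1
  symm
  refine Finset.card_equiv (Equiv.mulRight₀ ((e : ZMod p) / 2) h0) fun w => ?_
  simp only [mem_filter, mem_univ, true_and, Equiv.mulRight₀_apply]
  have h5 : quadraticChar (ZMod p)
        (-(e / 4 - t * (w * (e / 2)) + β * (w * (e / 2)) ^ 2))
      = quadraticChar (ZMod p) (-1) * -s
        * quadraticChar (ZMod p) (1 - 2 * t * w + e * β * w ^ 2) := by
    rw [← quadraticChar_mul_sq h2, ← hi, ← map_mul, ← map_mul]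
    congr 1
    have : (4 : ZMod p) = 2 ^ 2 := by norm_num
    rw [this]
    field_simp
  rw [h5]
  have h1 : quadraticChar (ZMod p) (-1) = 1 ∨ quadraticChar (ZMod p) (-1) = -1 :=
    quadraticChar_dichotomy (neg_ne_zero.mpr one_ne_zero)
  rcases hs with rfl | rfl <;> rcases h1 with h | h <;> rw [h] <;> constructor <;> intro _ <;> omega

/-- The weight of the codeword of `polarMap p e b`, as a function of the quadratic characters
`x` of `e * Q b` and `y` of `(Tr b) ^ 2 - e * Q b`, where `τ` is minus the quadratic character
of `-1`. -/
def weightOfSigns (p : ℕ) (P : ℚ) (τ x y : ℤ) : ℚ :=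
  ((p : ℚ) - 1) ^ 2 / 2 * P ^ 2 - (if τ = 1 then 1 else 0) * (p * P)
    + P * ((if τ = 1 then 1 else 0) - (if x = τ then 1 else 0)
      + (p - 1 - y + τ * if y = 0 then (p : ℚ) - 1 else -1) / 2)

omit [Fintype F] in
theorem hammingNorm_traceCodeword (D : Finset F) (a : F) :
    hammingNorm (traceCodeword p D a)
      + #{x ∈ D | Algebra.trace (ZMod p) F (a * x) = 0} = #D := by
  classical
  rw [← Finset.card_filter_add_card_filter_not (s := D)
    (fun x => Algebra.trace (ZMod p) F (a * x) = 0), add_comm]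
  congr 1
  rw [hammingNorm]
  refine Finset.card_bij (fun x _ => (x : F)) ?_ ?_ ?_
  · intro x hx
    simp only [mem_filter, mem_univ, true_and] at hx ⊢
    exact ⟨x.2, hx⟩
  · intro x _ y _ h
    exact Subtype.ext h
  · intro x hx
    rw [mem_filter] at hx
    exact ⟨⟨x, hx.1⟩, by
      simp only [mem_filter, mem_univ, true_and]
      exact hx.2, rfl⟩

/-- The joint law is summed over c in C_i. Each u is a root for exactly one c, namely the negative
of the remaining quadratic, so the root counts add up to the number of u for which this c lies in
C_i. -/
theorem card_definingSet_filter_trace (hp : p ≠ 2) (he : e % 4 = 2)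
    (hF : Fintype.card F = p ^ e) (i : Fin 2)
    {b : F} (hb : b ≠ 0) :
    (#{x ∈ definingSet p F i | Algebra.trace (ZMod p) F (polarMap p e b * x) = 0} : ℤ)
      = #{c : ZMod p | quadraticChar (ZMod p) c = (-1) ^ (i : ℕ)}
          * ((p ^ (e / 2 - 1)) ^ 2 + p ^ (e / 2 - 1))
        - p ^ (e / 2 - 1) * #{u : ZMod p | quadraticChar (ZMod p)
          (-(e / 4 - Algebra.trace (ZMod p) F b * u + traceNormForm p b * u ^ 2))
            = (-1) ^ (i : ℕ)} := by
  classical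
  have h2 : (2 : ZMod p) ≠ 0 := two_ne_zero_of_zmod_algebra (F := ZMod p) hp
  have htr : Algebra.trace (ZMod p) F (polarMap p e b * 2⁻¹) = Algebra.trace (ZMod p) F b := by
    have h3 : ((2 : F)⁻¹) = algebraMap (ZMod p) F 2⁻¹ := by rw [map_inv₀, map_ofNat]
    rw [h3, mul_comm, trace_algebraMap_mul, trace_polarMap (by omega) hF, inv_mul_cancel_left₀ h2]
  have h1 : #{x ∈ definingSet p F i | Algebra.trace (ZMod p) F (polarMap p e b * x) = 0}
      = #{y : F | quadraticChar (ZMod p) (traceNormForm p y - e / 4) = (-1) ^ (i : ℕ)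
        ∧ Algebra.trace (ZMod p) F (polarMap p e b * y) = -Algebra.trace (ZMod p) F b} := by
    symm
    refine Finset.card_equiv (Equiv.addRight (2⁻¹ : F)) fun y => ?_
    rw [Equiv.coe_addRight, mem_filter, mem_filter, mem_definingSet_add_half_iff hp (by omega) hF,
      mul_add, map_add, htr, eq_neg_iff_add_eq_zero]
    exact and_iff_right (mem_univ _)
  have h3 : #{y : F | quadraticChar (ZMod p) (traceNormForm p y - e / 4) = (-1) ^ (i : ℕ)
        ∧ Algebra.trace (ZMod p) F (polarMap p e b * y) = -Algebra.trace (ZMod p) F b}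
      = ∑ c : ZMod p with quadraticChar (ZMod p) c = (-1) ^ (i : ℕ),
        #{y : F | traceNormForm p y = c + e / 4
          ∧ Algebra.trace (ZMod p) F (polarMap p e b * y) = -Algebra.trace (ZMod p) F b} := by
    rw [Finset.card_eq_sum_card_fiberwise (f := fun y : F => traceNormForm p y - e / 4)
      (t := ({c | quadraticChar (ZMod p) c = (-1) ^ (i : ℕ)} : Finset (ZMod p)))]
    · refine Finset.sum_congr rfl fun c hc => ?_
      rw [Finset.filter_filter]
      congr 1
      ext y
      simp only [mem_filter, mem_univ, true_and, sub_eq_iff_eq_add] at hc ⊢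
      refine ⟨fun h => ⟨h.2, h.1.2⟩, fun h => ⟨⟨?_, h.2⟩, h.1⟩⟩
      rw [h.1, add_sub_cancel_right, hc]
    · intro y hy
      simp only [coe_filter, mem_univ, true_and, Set.mem_ofPred_eq] at hy ⊢
      exact hy.1
  have h4 : #{u : ZMod p | quadraticChar (ZMod p)
          (-(e / 4 - Algebra.trace (ZMod p) F b * u + traceNormForm p b * u ^ 2))
            = (-1) ^ (i : ℕ)}
      = ∑ c : ZMod p with quadraticChar (ZMod p) c = (-1) ^ (i : ℕ),
        #{u : ZMod p | c + e / 4 + -Algebra.trace (ZMod p) F b * u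
          + traceNormForm p b * u ^ 2 = 0} := by
    rw [Finset.card_eq_sum_card_fiberwise (f := fun u : ZMod p =>
      -((e : ZMod p) / 4 - Algebra.trace (ZMod p) F b * u + traceNormForm p b * u ^ 2))
      (t := ({c | quadraticChar (ZMod p) c = (-1) ^ (i : ℕ)} : Finset (ZMod p)))]
    · refine Finset.sum_congr rfl fun c hc => ?_
      rw [Finset.filter_filter]
      congr 1
      ext u
      simp only [mem_filter, mem_univ, true_and] at hc ⊢
      refine ⟨fun h => by linear_combination -h.2, fun h => ?_⟩
      have h5 : -((e : ZMod p) / 4 - Algebra.trace (ZMod p) F b * u + traceNormForm p b * u ^ 2)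
        = c := by linear_combination -h
      exact ⟨by rw [h5, hc], h5⟩
    · intro y hy
      simpa only [coe_filter, mem_univ, true_and, Set.mem_ofPred_eq] using hy
  rw [h1, h3, h4]
  push_cast
  simp only [card_form_eq_and_trace_eq hp he hF hb]
  rw [Finset.sum_sub_distrib, ← Finset.mul_sum, Finset.sum_sub_distrib, Finset.sum_const,
    Finset.sum_const]
  simp only [nsmul_eq_mul]
  ring

theorem hammingNorm_traceCodeword_polarMap (hp : p ≠ 2) (he : e % 4 = 2)
    (hF : Fintype.card F = p ^ e) (i : Fin 2)
    (hi : quadraticChar (ZMod p) (e : ZMod p) = -(-1) ^ (i : ℕ)) {b : F} (hb : b ≠ 0) :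
    (hammingNorm (traceCodeword p (definingSet p F i) (polarMap p e b)) : ℚ)
      = weightOfSigns p (p ^ (e / 2 - 1)) (-quadraticChar (ZMod p) (-1))
          (quadraticChar (ZMod p) (e * traceNormForm p b))
          (quadraticChar (ZMod p)
            (Algebra.trace (ZMod p) F b ^ 2 - e * traceNormForm p b)) := by
  have hσ : ((-1) ^ (i : ℕ) : ℤ) = 1 ∨ ((-1) ^ (i : ℕ) : ℤ) = -1 := neg_one_pow_eq_or ℤ _
  have he0 : (e : ZMod p) ≠ 0 := by
    intro h
    rw [h, quadraticChar_zero] at hi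
    omega
  have h1 : quadraticChar (ZMod p) (-1) = 1 ∨ quadraticChar (ZMod p) (-1) = -1 :=
    quadraticChar_dichotomy (neg_ne_zero.mpr one_ne_zero)
  have hτ : -quadraticChar (ZMod p) (-1) = 1 ∨ -quadraticChar (ZMod p) (-1) = -1 := by omega
  have hsum := hammingNorm_traceCodeword (p := p) (definingSet p F i) (polarMap p e b)
  have hD := two_mul_card_definingSet hp he hF i hi
  have hn := card_definingSet_filter_trace hp he hF i hb
  rw [card_quadraticChar_shifted_eq hp he0 hσ hi, card_quadraticChar_quadratic_eq] at hn
  have hC := two_mul_card_quadraticChar_eq hp hσ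
  have hU := two_mul_card_quadraticChar_sq_sub_eq hp
    (Algebra.trace (ZMod p) F b ^ 2 - e * traceNormForm p b) hτ
  have hif : (if quadraticChar (ZMod p) (-1) = -1 then (1 : ℤ) else 0)
      = if -quadraticChar (ZMod p) (-1) = 1 then 1 else 0 := by
    congr 1
    simp only [eq_iff_iff]
    omega
  rw [hif] at hD
  rw [weightOfSigns]
  simp only [quadraticChar_eq_zero_iff]
  rw [← @Nat.cast_inj ℚ] at hsum
  rw [← @Int.cast_inj ℚ] at hD hn hC hU
  push_cast at hsum hD hn hC hU ⊢
  linear_combination hsum + hD / 2 - hn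
    - ((p ^ (e / 2 - 1)) ^ 2 + (p : ℚ) ^ (e / 2 - 1)) / 2 * hC + (p : ℚ) ^ (e / 2 - 1) / 2 * hU

/-- The joint distribution of `e * Q` and the trace, expressed through quadratic characters. -/
theorem sum_signs (hp : p ≠ 2) (he : e % 4 = 2) (hF : Fintype.card F = p ^ e)
    (he0 : (e : ZMod p) ≠ 0) (g : ℤ → ℤ → ℚ) :
    ∑ b : F, g (quadraticChar (ZMod p) (e * traceNormForm p b))
        (quadraticChar (ZMod p) (Algebra.trace (ZMod p) F b ^ 2 - e * traceNormForm p b))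
      = ∑ v : ZMod p, ∑ t : ZMod p, g (quadraticChar (ZMod p) v)
          (quadraticChar (ZMod p) (t ^ 2 - v)) * ((p ^ (e / 2 - 1)) ^ 2
            - p ^ (e / 2 - 1) * quadraticChar (ZMod p) (t ^ 2 - v)) := by
  classical
  have h2 : (2 : ZMod p) ≠ 0 := two_ne_zero_of_zmod_algebra (F := ZMod p) hp
  have h2F : (2 : F) ≠ 0 := two_ne_zero_of_zmod_algebra hp
  have h4 : (4 : ZMod p) ≠ 0 := four_ne_zero_zmod hp
  -- The joint law is applied with b = 1/2, where Q(1/2) = e/4. The quadratic v/e + tu + (e/4)u² has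
  -- discriminant t² - v, hence η(t² - v) + 1 roots.
  have hM : ∀ v t : ZMod p,
      (#{b : F | (e * traceNormForm p b, Algebra.trace (ZMod p) F b) = (v, t)} : ℚ)
        = (p ^ (e / 2 - 1)) ^ 2 - p ^ (e / 2 - 1) * quadraticChar (ZMod p) (t ^ 2 - v) := by
    intro v t
    have h := card_form_eq_and_trace_eq hp he hF (inv_ne_zero h2F) (v / e) t
    have hR : #{u : ZMod p | v / e + t * u + traceNormForm p ((2 : F)⁻¹) * u ^ 2 = 0}
        = #{z : ZMod p | z ^ 2 = t ^ 2 - v} := by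
      refine Finset.card_equiv ((Equiv.mulLeft₀ ((e : ZMod p) / 2) (div_ne_zero he0 h2)).trans
        (Equiv.addRight t)) fun u => ?_
      simp only [mem_filter, mem_univ, true_and, Equiv.trans_apply, Equiv.coe_addRight,
        Equiv.mulLeft₀_apply, traceNormForm_half hF]
      have h5 : (e / 2 * u + t) ^ 2 - (t ^ 2 - v)
          = e * (v / e + t * u + (e : ZMod p) / 4 * u ^ 2) := by
        have : (4 : ZMod p) = 2 ^ 2 := by norm_num
        rw [this]
        field_simp
        ring
      rw [← sub_eq_zero (b := t ^ 2 - v), h5, mul_eq_zero, or_iff_right he0]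
    rw [hR, card_sq_eq hp, add_sub_cancel_right, polarMap_half hp] at h
    have h6 : #{b : F | (e * traceNormForm p b, Algebra.trace (ZMod p) F b) = (v, t)}
        = #{y : F | traceNormForm p y = v / e ∧ Algebra.trace (ZMod p) F (1 * y) = t} := by
      congr 1
      ext y
      simp only [mem_filter, mem_univ, true_and, Prod.mk.injEq, one_mul, eq_div_iff he0]
      rw [mul_comm]
    rw [h6]
    exact_mod_cast h
  rw [← Finset.sum_fiberwise (s := univ)
    (g := fun b : F => ((e : ZMod p) * traceNormForm p b, Algebra.trace (ZMod p) F b)),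
    Fintype.sum_prod_type]
  refine Finset.sum_congr rfl fun v _ => Finset.sum_congr rfl fun t _ => ?_
  rw [← hM, mul_comm, ← nsmul_eq_mul, ← Finset.sum_const]
  refine Finset.sum_congr rfl fun b hb => ?_
  have hb := (mem_filter.mp hb).2
  simp only [Prod.mk.injEq] at hb
  rw [hb.1, hb.2]

end Weight

/-! ### Coincidence and positivity of the weights -/

/-- The values that `weightOfSigns` takes on nonzero codewords. -/
def weightSet (p : ℕ) (P : ℚ) (τ : ℤ) : Finset ℚ :=
  {weightOfSigns p P τ 0 0, weightOfSigns p P τ 0 1, weightOfSigns p P τ 1 0,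
    weightOfSigns p P τ 1 1, weightOfSigns p P τ (-1) (-1), weightOfSigns p P τ 1 (-1),
    weightOfSigns p P τ (-1) 1}

theorem card_weightSet_le (p : ℕ) (P : ℚ) {τ : ℤ} (hτ : τ = 1 ∨ τ = -1) :
    #(weightSet p P τ) ≤ 5 := by
  -- For τ = 1 the sign pairs (0,1), (-1,1), (1,-1) share a weight. For τ = -1, (1,1) and (-1,-1)
  -- share the weight of (0,1), and the shifts by -P and P put the weights of (-1,1) and (1,-1) in
  -- their places.
  have hsub : weightSet p P τ ⊆ {weightOfSigns p P τ 0 0, weightOfSigns p P τ 0 1,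
      weightOfSigns p P τ 1 0, weightOfSigns p P τ 1 1 + (if τ = 1 then 0 else -P),
      weightOfSigns p P τ (-1) (-1) + (if τ = 1 then 0 else P)} := by
    intro x hx
    simp only [weightSet, mem_insert, mem_singleton] at hx ⊢
    rcases hτ with rfl | rfl <;> norm_num [weightOfSigns] at hx ⊢ <;>
      rcases hx with h | h | h | h | h | h | h <;> subst h <;> ring_nf <;> simp
  exact (Finset.card_le_card hsub).trans (Finset.card_le_five)

/-- Two sign pairs are impossible: v = 0 makes t² - v a square, and t² = v makes v a square. -/
theorem weightOfSigns_mem_weightSet {p : ℕ} [Fact p.Prime] (P : ℚ) (τ : ℤ) (v t : ZMod p) :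
    weightOfSigns p P τ (quadraticChar (ZMod p) v) (quadraticChar (ZMod p) (t ^ 2 - v))
      ∈ weightSet p P τ := by
  have h1 : quadraticChar (ZMod p) v = 0 → quadraticChar (ZMod p) (t ^ 2 - v) ≠ -1 := by
    intro h
    rw [quadraticChar_eq_zero_iff] at h
    rw [h, sub_zero, map_pow]
    nlinarith [sq_nonneg (quadraticChar (ZMod p) t)]
  have h2 : quadraticChar (ZMod p) v = -1 → quadraticChar (ZMod p) (t ^ 2 - v) ≠ 0 := by
    intro h h'
    rw [quadraticChar_eq_zero_iff, sub_eq_zero] at h'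
    rw [← h', map_pow] at h
    nlinarith [sq_nonneg (quadraticChar (ZMod p) t)]
  rcases quadraticChar_trichotomy v with h | h | h <;>
    rcases quadraticChar_trichotomy (t ^ 2 - v) with h' | h' | h' <;>
    rw [h, h'] <;> first
      | exact absurd h' (h1 h)
      | exact absurd h' (h2 h)
      | simp [weightSet]

/-- The critical value is P((p-1)²P - (p+3))/2, attained at signs (1,1) for τ = 1. Positivity really
fails for p = 3, P = 1: the weight at (0,1) is then 0. -/
theorem pos_of_mem_weightSet {p : ℕ} {P : ℚ} {τ : ℤ} (hτ : τ = 1 ∨ τ = -1) (hp : 3 ≤ p)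
    (hP : 1 ≤ P) (h : 5 ≤ p ∨ 9 ≤ P) {x : ℚ} (hx : x ∈ weightSet p P τ) : 0 < x := by
  have hp' : (3 : ℚ) ≤ p := by exact_mod_cast hp
  have h0 : (p : ℚ) + 3 < (p - 1) ^ 2 * P := by
    rcases h with h | h
    · have h5 : (5 : ℚ) ≤ p := by exact_mod_cast h
      nlinarith [mul_le_mul_of_nonneg_left hP (sq_nonneg ((p : ℚ) - 1))]
    · nlinarith [mul_le_mul_of_nonneg_left h (sq_nonneg ((p : ℚ) - 1))]
  have h1 : 0 < P * ((p - 1) ^ 2 * P - (p + 3)) := mul_pos (by linarith) (by linarith)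
  have h2 : 0 ≤ P * (p - 3) := mul_nonneg (by linarith) (by linarith)
  simp only [weightSet, mem_insert, mem_singleton] at hx
  rcases hτ with rfl | rfl <;> norm_num [weightOfSigns] at hx <;>
    rcases hx with h | h | h | h | h | h | h <;> subst h <;> nlinarith

/-! ### Dimension and weight distribution -/

section Code

variable {p e : ℕ} [Fact p.Prime] {F : Type*} [Field F] [Algebra (ZMod p) F] [Fintype F]

theorem hammingNorm_mem_weightSet (hp : p ≠ 2) (he : e % 4 = 2)
    (hF : Fintype.card F = p ^ e) (i : Fin 2)
    (hi : quadraticChar (ZMod p) (e : ZMod p) = -(-1) ^ (i : ℕ)) {a : F} (ha : a ≠ 0) :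
    (hammingNorm (traceCodeword p (definingSet p F i) a) : ℚ)
      ∈ weightSet p (p ^ (e / 2 - 1)) (-quadraticChar (ZMod p) (-1)) := by
  obtain ⟨b, rfl⟩ := (polarMap_bijective hp he hF).2 a
  have hb : b ≠ 0 := (polarMap_eq_zero_iff hp he hF).not.mp ha
  rw [hammingNorm_traceCodeword_polarMap hp he hF i hi hb]
  exact weightOfSigns_mem_weightSet _ _ _ _

theorem neg_quadraticChar_neg_one_eq_or :
    -quadraticChar (ZMod p) (-1) = 1 ∨ -quadraticChar (ZMod p) (-1) = -1 := by
  have h1 : quadraticChar (ZMod p) (-1) = 1 ∨ quadraticChar (ZMod p) (-1) = -1 :=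
    quadraticChar_dichotomy (neg_ne_zero.mpr one_ne_zero)
  omega

theorem numNonzeroWeights_traceCode_le (hp : p ≠ 2) (he : e % 4 = 2)
    (hF : Fintype.card F = p ^ e) (i : Fin 2)
    (hi : quadraticChar (ZMod p) (e : ZMod p) = -(-1) ^ (i : ℕ)) :
    numNonzeroWeights (traceCode p (definingSet p F i)) ≤ 5 := by
  classical
  refine le_trans ?_ (card_weightSet_le p (p ^ (e / 2 - 1))
    (neg_quadraticChar_neg_one_eq_or (p := p)))
  refine Finset.card_le_card_of_injOn (fun w : ℕ => (w : ℚ)) ?_ Nat.cast_injective.injOn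
  intro w hw
  simp only [coe_filter, mem_Icc, Set.mem_ofPred_eq] at hw
  obtain ⟨⟨hw1, -⟩, hw2⟩ := hw
  obtain ⟨⟨c, hc⟩⟩ := (Nat.card_ne_zero.mp hw2).1
  obtain ⟨⟨c, a, rfl⟩, hw⟩ := (⟨c, hc⟩ : {c : traceCode p (definingSet p F i) //
    hammingNorm (c : definingSet p F i → ZMod p) = w})
  have ha : a ≠ 0 := by
    rintro rfl
    simp only [map_zero, hammingNorm_zero] at hw
    omega
  simp only at hw
  rw [← hw]
  exact hammingNorm_mem_weightSet hp he hF i hi ha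

theorem traceCodeword_injective (hp : p ≠ 2) (he : e % 4 = 2)
    (hF : Fintype.card F = p ^ e) (i : Fin 2)
    (hi : quadraticChar (ZMod p) (e : ZMod p) = -(-1) ^ (i : ℕ)) (hpe : ¬(p = 3 ∧ e = 2)) :
    Function.Injective (traceCodeword p (definingSet p F i)) := by
  rw [← LinearMap.ker_eq_bot, LinearMap.ker_eq_bot']
  intro a h
  by_contra ha
  have hp3 : 3 ≤ p := (Fact.out : p.Prime).two_le.lt_of_ne hp.symm
  have hodd := (Fact.out : p.Prime).odd_of_ne_two hp
  have hP : (1 : ℚ) ≤ (p : ℚ) ^ (e / 2 - 1) := by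
    exact_mod_cast Nat.one_le_pow _ _ (by omega)
  -- For p = 3 the exclusion of e = 2 leaves e ≥ 6, so the exponent e/2 - 1 is at least 2.
  have hor : 5 ≤ p ∨ (9 : ℚ) ≤ (p : ℚ) ^ (e / 2 - 1) := by
    by_cases h3 : p = 3
    · right
      have h9 : 3 ^ 2 ≤ p ^ (e / 2 - 1) := by
        rw [h3]
        exact Nat.pow_le_pow_right (by norm_num) (by omega)
      exact_mod_cast h9
    · left
      rcases hodd with ⟨k, hk⟩
      omega
  have := pos_of_mem_weightSet neg_quadraticChar_neg_one_eq_or hp3 hP hor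
    (hammingNorm_mem_weightSet hp he hF i hi ha)
  rw [h, hammingNorm_zero] at this
  simp at this

theorem finrank_traceCode (hF : Fintype.card F = p ^ e) {D : Finset F}
    (hinj : Function.Injective (traceCodeword p D)) :
    Module.finrank (ZMod p) (traceCode p D) = e := by
  rw [traceCode, LinearMap.finrank_range_of_inj hinj, finrank_eq_of_card hF]

theorem codeWeightCount_traceCode {D : Finset F}
    (hinj : Function.Injective (traceCodeword p D)) (w : ℕ) :
    codeWeightCount (traceCode p D) w = #{a : F | hammingNorm (traceCodeword p D a) = w} := by
  rw [codeWeightCount, ← Fintype.card_subtype, ← Nat.card_eq_fintype_card]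
  symm
  refine Nat.card_congr (Equiv.subtypeEquiv (LinearEquiv.ofInjective _ hinj).toEquiv fun a => ?_)
  rfl

theorem codeWeightCount_eq (hp : p ≠ 2) (he : e % 4 = 2)
    (hF : Fintype.card F = p ^ e) (i : Fin 2)
    (hi : quadraticChar (ZMod p) (e : ZMod p) = -(-1) ^ (i : ℕ))
    (hinj : Function.Injective (traceCodeword p (definingSet p F i))) (w : ℕ) {P : ℚ} {τ : ℤ}
    (hP : P = p ^ (e / 2 - 1)) (hτ : τ = -quadraticChar (ZMod p) (-1)) {ψ : ℚ → ℚ}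
    (hψ : ψ = fun x => if x = (w : ℚ) then 1 else 0) :
    (codeWeightCount (traceCode p (definingSet p F i)) w : ℚ)
      = ψ 0 + (P ^ 2 - 1) * ψ (weightOfSigns p P τ 0 0)
        + (p - 1) * (P ^ 2 - P) * ψ (weightOfSigns p P τ 0 1)
        + (p - 1) * P ^ 2 * ψ (weightOfSigns p P τ 1 0)
        + (p - 1) * (p - 3) / 4 * (P ^ 2 - P) * ψ (weightOfSigns p P τ 1 1)
        + (p - 1) ^ 2 / 4 * (P ^ 2 + P) * ψ (weightOfSigns p P τ 1 (-1))
        + (p - 1) ^ 2 / 4 * (P ^ 2 - P) * ψ (weightOfSigns p P τ (-1) 1)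
        + (p - 1) * (p + 1) / 4 * (P ^ 2 + P) * ψ (weightOfSigns p P τ (-1) (-1)) := by
  classical
  have he0 : (e : ZMod p) ≠ 0 := by
    intro h
    rw [h, quadraticChar_zero] at hi
    rcases neg_one_pow_eq_or ℤ (i : ℕ) with h | h <;> omega
  have h1 : #{a : F | hammingNorm (traceCodeword p (definingSet p F i) a) = w}
      = #{b : F | hammingNorm (traceCodeword p (definingSet p F i) (polarMap p e b)) = w} := by
    symm
    refine Finset.card_equiv (Equiv.ofBijective _ (polarMap_bijective hp he hF)) fun b => ?_
    simp
  rw [codeWeightCount_traceCode hinj, h1, ← Finset.sum_boole,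
    ← Finset.add_sum_erase _ _ (mem_univ (0 : F)), polarMap_zero, map_zero, hammingNorm_zero]
  have h2 : ∀ b ∈ univ.erase (0 : F),
      (if hammingNorm (traceCodeword p (definingSet p F i) (polarMap p e b)) = w then (1 : ℚ) else 0)
      = ψ (weightOfSigns p P τ (quadraticChar (ZMod p) (e * traceNormForm p b))
          (quadraticChar (ZMod p)
            (Algebra.trace (ZMod p) F b ^ 2 - e * traceNormForm p b))) := by
    intro b hb
    rw [hP, hτ, ← hammingNorm_traceCodeword_polarMap hp he hF i hi (ne_of_mem_erase hb), hψ]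
    simp only [Nat.cast_inj]
  have h3 := sum_signs hp he hF he0 (fun x y => ψ (weightOfSigns p P τ x y))
  -- The element b = 0 has signs (0,0) in the sum over F, but its codeword has weight 0. Moving it
  -- out turns the multiplicity P² of (0,0) into P² - 1.
  rw [← Finset.add_sum_erase _ _ (mem_univ (0 : F)),
    sum_quadraticChar_pair hp (fun x y => ψ (weightOfSigns p P τ x y)
      * ((p ^ (e / 2 - 1)) ^ 2 - p ^ (e / 2 - 1) * y))] at h3
  simp only [← hP, traceNormForm_zero, mul_zero, map_zero, quadraticChar_zero, sub_zero] at h3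
  rw [zero_pow two_ne_zero, quadraticChar_zero] at h3
  have h4 : (if 0 = w then (1 : ℚ) else 0) = ψ 0 := by
    rw [hψ]
    simp only [← Nat.cast_zero (R := ℚ), Nat.cast_inj]
  rw [Finset.sum_congr rfl h2, h4]
  push_cast at h3
  linear_combination h3

theorem hasWeightTable_oneModFour (hp : p ≠ 2) (he : e % 4 = 2)
    (hF : Fintype.card F = p ^ e) (i : Fin 2)
    (hi : quadraticChar (ZMod p) (e : ZMod p) = -(-1) ^ (i : ℕ))
    (hinj : Function.Injective (traceCodeword p (definingSet p F i))) (hp4 : p % 4 = 1) :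
    HasWeightTable (traceCode p (definingSet p F i)) (tableOneModFour p e) := by
  intro w
  have hτ : (-1 : ℤ) = -quadraticChar (ZMod p) (-1) := by
    rw [(quadraticChar_one_iff_isSquare (neg_ne_zero.mpr one_ne_zero)).mpr
      ((ZMod.exists_sq_eq_neg_one_iff (p := p)).mpr (by omega))]
  -- With ψ opaque, rows of equal weight become equal terms ψ(·), and `ring` adds their
  -- multiplicities.
  obtain ⟨ψ, hψ⟩ : ∃ ψ : ℚ → ℚ, ψ = fun x => if x = (w : ℚ) then 1 else 0 := ⟨_, rfl⟩
  obtain ⟨P, hP⟩ : ∃ P : ℚ, P = (p : ℚ) ^ (e / 2 - 1) := ⟨_, rfl⟩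
  have hrow : ∀ x m : ℚ, (if x = (w : ℚ) then m else 0) = m * ψ x := fun x m => by
    rw [hψ]
    simp
  have hP2 : (p : ℚ) ^ (e - 2) = P ^ 2 := by
    rw [hP, ← pow_mul]
    congr 1
    omega
  have hP1 : (p : ℚ) ^ (e - 1) = p * P ^ 2 := by
    rw [← hP2, ← pow_succ']
    congr 1
    omega
  rw [codeWeightCount_eq hp he hF i hi hinj w hP hτ hψ]
  simp only [tableOneModFour, List.map_cons, List.map_nil, List.sum_cons, List.sum_nil, hrow,
    hP2, hP1, ← hP]
  have e00 : weightOfSigns p P (-1) 0 0 = ((p : ℚ) - 1) ^ 2 / 2 * P ^ 2 := by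
    norm_num [weightOfSigns]
  have e10 : weightOfSigns p P (-1) 1 0 = ((p : ℚ) - 1) ^ 2 / 2 * P ^ 2 := by
    norm_num [weightOfSigns]
  have e01 : weightOfSigns p P (-1) 0 1
      = ((p : ℚ) - 1) ^ 2 / 2 * P ^ 2 + ((p : ℚ) - 1) / 2 * P := by
    norm_num [weightOfSigns]; ring
  have e11 : weightOfSigns p P (-1) 1 1
      = ((p : ℚ) - 1) ^ 2 / 2 * P ^ 2 + ((p : ℚ) - 1) / 2 * P := by
    norm_num [weightOfSigns]; ring
  have emm : weightOfSigns p P (-1) (-1) (-1)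
      = ((p : ℚ) - 1) ^ 2 / 2 * P ^ 2 + ((p : ℚ) - 1) / 2 * P := by
    norm_num [weightOfSigns]; ring
  have em1 : weightOfSigns p P (-1) (-1) 1
      = ((p : ℚ) - 1) ^ 2 / 2 * P ^ 2 + ((p : ℚ) - 3) / 2 * P := by
    norm_num [weightOfSigns]; ring
  have e1m : weightOfSigns p P (-1) 1 (-1)
      = ((p : ℚ) - 1) ^ 2 / 2 * P ^ 2 + ((p : ℚ) + 1) / 2 * P := by
    norm_num [weightOfSigns]; ring
  rw [e00, e10, e01, e11, emm, em1, e1m]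
  ring

theorem hasWeightTable_threeModFour (hp : p ≠ 2) (he : e % 4 = 2)
    (hF : Fintype.card F = p ^ e) (i : Fin 2)
    (hi : quadraticChar (ZMod p) (e : ZMod p) = -(-1) ^ (i : ℕ))
    (hinj : Function.Injective (traceCodeword p (definingSet p F i))) (hp4 : p % 4 = 3) :
    HasWeightTable (traceCode p (definingSet p F i)) (tableThreeModFour p e) := by
  intro w
  have hτ : (1 : ℤ) = -quadraticChar (ZMod p) (-1) := by
    rw [quadraticChar_neg_one_iff_not_isSquare.mpr
      ((ZMod.exists_sq_eq_neg_one_iff (p := p)).not.mpr (by omega)), neg_neg]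
  obtain ⟨ψ, hψ⟩ : ∃ ψ : ℚ → ℚ, ψ = fun x => if x = (w : ℚ) then 1 else 0 := ⟨_, rfl⟩
  obtain ⟨P, hP⟩ : ∃ P : ℚ, P = (p : ℚ) ^ (e / 2 - 1) := ⟨_, rfl⟩
  have hrow : ∀ x m : ℚ, (if x = (w : ℚ) then m else 0) = m * ψ x := fun x m => by
    rw [hψ]
    simp
  have hP2 : (p : ℚ) ^ (e - 2) = P ^ 2 := by
    rw [hP, ← pow_mul]
    congr 1
    omega
  rw [codeWeightCount_eq hp he hF i hi hinj w hP hτ hψ]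
  simp only [tableThreeModFour, List.map_cons, List.map_nil, List.sum_cons, List.sum_nil, hrow,
    hP2, ← hP]
  have e00 : weightOfSigns p P 1 0 0 = ((p : ℚ) - 1) ^ 2 / 2 * P ^ 2 := by
    norm_num [weightOfSigns]; ring
  have e10 : weightOfSigns p P 1 1 0 = ((p : ℚ) - 1) ^ 2 / 2 * P ^ 2 - P := by
    norm_num [weightOfSigns]; ring
  have e01 : weightOfSigns p P 1 0 1
      = ((p : ℚ) - 1) ^ 2 / 2 * P ^ 2 - ((p : ℚ) + 1) / 2 * P := by
    norm_num [weightOfSigns]; ring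
  have em1 : weightOfSigns p P 1 (-1) 1
      = ((p : ℚ) - 1) ^ 2 / 2 * P ^ 2 - ((p : ℚ) + 1) / 2 * P := by
    norm_num [weightOfSigns]; ring
  have e1m : weightOfSigns p P 1 1 (-1)
      = ((p : ℚ) - 1) ^ 2 / 2 * P ^ 2 - ((p : ℚ) + 1) / 2 * P := by
    norm_num [weightOfSigns]; ring
  have e11 : weightOfSigns p P 1 1 1
      = ((p : ℚ) - 1) ^ 2 / 2 * P ^ 2 - ((p : ℚ) + 3) / 2 * P := by
    norm_num [weightOfSigns]; ring
  have emm : weightOfSigns p P 1 (-1) (-1)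
      = ((p : ℚ) - 1) ^ 2 / 2 * P ^ 2 - ((p : ℚ) - 1) / 2 * P := by
    norm_num [weightOfSigns]; ring
  rw [e00, e10, e01, e11, emm, em1, e1m]
  ring

end Code

theorem theorem6 (p e : ℕ) [Fact p.Prime] (hp : p ≠ 2) (he : e % 4 = 2)
    (F : Type*) [Field F] [Fintype F] [Algebra (ZMod p) F] (hF : Fintype.card F = p ^ e)
    (i : Fin 2) (hi : legendreSym p (e : ℤ) = (-1) ^ (1 - (i : ℕ))) :
    ((definingSet p F i).card : ℚ) =
        ((p : ℚ) - 1) / 2 * (p : ℚ) ^ (e - 1)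
          - (1 - (quadraticChar (ZMod p) (-1) : ℚ) * (p : ℚ)) / 2 * (p : ℚ) ^ (e / 2 - 1) ∧
      numNonzeroWeights (traceCode p (definingSet p F i)) ≤ 5 ∧
      (¬ (p = 3 ∧ e = 2) →
        Module.finrank (ZMod p) (traceCode p (definingSet p F i)) = e ∧
        (p % 4 = 1 →
          HasWeightTable (traceCode p (definingSet p F i)) (tableOneModFour p e)) ∧
        (p % 4 = 3 →
          HasWeightTable (traceCode p (definingSet p F i)) (tableThreeModFour p e))) := by
  have hi' : quadraticChar (ZMod p) (e : ZMod p) = -(-1) ^ (i : ℕ) := by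
    rw [legendreSym, Int.cast_natCast] at hi
    rw [hi]
    fin_cases i <;> norm_num
  refine ⟨?_, numNonzeroWeights_traceCode_le hp he hF i hi', fun hpe => ?_⟩
  · have h := two_mul_card_definingSet hp he hF i hi'
    have h1 : (p : ℚ) ^ (e - 1) = p * (p ^ (e / 2 - 1)) ^ 2 := by
      rw [← pow_mul, ← pow_succ']
      congr 1
      omega
    have hη : quadraticChar (ZMod p) (-1) = 1 ∨ quadraticChar (ZMod p) (-1) = -1 :=
      quadraticChar_dichotomy (neg_ne_zero.mpr one_ne_zero)
    rw [← @Int.cast_inj ℚ] at h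
    rw [h1]
    rcases hη with hη | hη <;> rw [hη] at h ⊢ <;> norm_num at h ⊢ <;> linear_combination h / 2
  · have hinj := traceCodeword_injective hp he hF i hi' hpe
    exact ⟨finrank_traceCode hF hinj, hasWeightTable_oneModFour hp he hF i hi' hinj,
      hasWeightTable_threeModFour hp he hF i hi' hinj⟩
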